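/- Let $d\in\mathbb N$, let $H\le \mathrm{GL}(\mathbb R^d)$ be a closed subgroup and suppose that there is $\xi_0\in\mathbb R^d$ such that the dual orbit $\mathcal O=\{h^T\xi_0 : h\in H\}$ is open with Lebesgue-null complement and the isotropy group $\{h\in H: h^T\xi_0=\xi_0\}$ is compact. Let $G=\mathbb R^d\rtimes H$, with product $(x,h)(y,g)=(x+hy,hg)$ and left Haar measure $\mathrm dx\,\mathrm dh/|\det h|$, where $\mathrm dh$ is a left Haar measure on $H$. For $\psi,f\in L^2(\mathbb R^d)$ put $(\pi(x,h)\psi)(y)=|\det h|^{-1/2}\psi(h^{-1}(y-x))$ and $(W_\psi f)(x,h)=\langle f,\pi(x,h)\psi\rangle_{L^2}$ (linear in $f$). Let $w:H\to(0,\infty)$ be a weight, that is, measurable and submultiplicative ($w(gh)\le w(g)w(h)$), and let $w$ be locally bounded; extend it to $G$ by $w(x,h)=w(h)$. Fix $\psi\in L^2(\mathbb R^d)\setminus\{0\}$ with $W_\psi\psi\in L^1_w(G)$ and set $\mathcal H^1_w=\{f\in L^2(\mathbb R^d): W_\psi f\in L^1_w(G)\}$ with norm $\|f\|_{\mathcal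 H^1_w}=\|W_\psi f\|_{L^1_w(G)}$. Let $(\mathcal H^1_w)^{\neg}$ be the space of bounded antilinear functionals on $\mathcal H^1_w$, with the weak-$*$ topology (pointwise convergence on $\mathcal H^1_w$). Let $\mathcal D(\mathcal O)=C_c^\infty(\mathcal O)$ be the space of complex test functions with its usual topology, and $\mathcal D'(\mathcal O)$ the space of continuous linear functionals on it, with the topology of pointwise convergence on $\mathcal D(\mathcal O)$. Let $(\mathcal F^{-1}g)(x)=\int_{\mathbb R^d} g(\xi)e^{2\pi i\langle x,\xi\rangle}\,\mathrm d\xi$. Then $\mathcal F^{-1}g\in\mathcal H^1_w$ for every $g\in\mathcal D(\mathcal O)$; for every $f\in(\mathcal H^1_w)^{\neg}$ the map $$\mathcal Ff:\mathcal D(\mathcal O)\to\mathbb C,\qquad g\mapsto f(\mathcal F^{-1}\overline g)$$ is linear and continuous, i.e. $\mathcal Ff\in\mathcal D'(\mathcal O)$; and the map $\mathcal F:(\mathcal H^1_w)^{\neg}\to\mathcal D'(\mathcal O)$, $f\mapsto\mathcal Ff$, is linear, injective and continuous. Thus $(\mathcal H^1_w)^{\neg}$ is identified with a linear subspace of $\mathcal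 D'(\mathcal O)$. -/

import Mathlib

open MeasureTheory Topology
open scoped ENNReal Distributions FourierTransform

noncomputable section

namespace WaveletCoorbit

/-- Euclidean space `ℝ^d`. -/
abbrev Space (d : ℕ) : Type := EuclideanSpace ℝ (Fin d)

/-- The Hilbert space `L²(ℝ^d)` of complex-valued functions, with respect to Lebesgue measure. -/
abbrev L2 (d : ℕ) : Type := Lp ℂ 2 (volume : Measure (Space d))

variable {d : ℕ}

/-- The dual orbit `H^T ξ₀ = {h^T ξ₀ : h ∈ H}`. -/
def dualOrbit (H : Subgroup (GL (Fin d) ℝ)) (ξ₀ : Space d) : Set (Space d) :=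
  {ξ | ∃ h : H, Matrix.toEuclideanLin ((h : GL (Fin d) ℝ) : Matrix (Fin d) (Fin d) ℝ).transpose ξ₀
    = ξ}

/-- The isotropy group `{h ∈ H : h^T ξ₀ = ξ₀}` of the dual action, as a subset of `H`. -/
def isotropy (H : Subgroup (GL (Fin d) ℝ)) (ξ₀ : Space d) : Set H :=
  {h | Matrix.toEuclideanLin ((h : GL (Fin d) ℝ) : Matrix (Fin d) (Fin d) ℝ).transpose ξ₀ = ξ₀}

/-- The standing admissibility assumptions on the dilation group `H`: it is a closed subgroup of
`GL(ℝ^d)`, the dual orbit of `ξ₀` is open and of full Lebesgue measure, and the isotropy group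
of `ξ₀` is compact. -/
structure IsAdmissible (H : Subgroup (GL (Fin d) ℝ)) (ξ₀ : Space d) : Prop where
  isClosed : IsClosed (H : Set (GL (Fin d) ℝ))
  isOpen_orbit : IsOpen (dualOrbit H ξ₀)
  orbit_full : volume (dualOrbit H ξ₀)ᶜ = 0
  isCompact_isotropy : IsCompact (isotropy H ξ₀)

/-- The dual orbit as an open set. -/
def IsAdmissible.orbit {H : Subgroup (GL (Fin d) ℝ)} {ξ₀ : Space d} (hH : IsAdmissible H ξ₀) :
    TopologicalSpace.Opens (Space d) :=
  ⟨dualOrbit H ξ₀, hH.isOpen_orbit⟩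

/-- A weight on `H`: a positive, measurable, locally bounded, submultiplicative function. -/
structure IsWeight (H : Subgroup (GL (Fin d) ℝ)) [MeasurableSpace H] (w : H → ℝ) : Prop where
  pos : ∀ h, 0 < w h
  measurable : Measurable w
  locallyBounded : ∀ h, ∃ C : ℝ, ∀ᶠ k in 𝓝 h, w k ≤ C
  submultiplicative : ∀ g h, w (g * h) ≤ w g * w h

/-- The affine map `y ↦ h⁻¹ (y - x)`. -/
def affineInv (x : Space d) (h : GL (Fin d) ℝ) (y : Space d) : Space d :=
  Matrix.toEuclideanLin ((h⁻¹ : GL (Fin d) ℝ) : Matrix (Fin d) (Fin d) ℝ) (y - x)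

theorem det_toEuclideanLin_ne_zero (h : GL (Fin d) ℝ) :
    LinearMap.det (Matrix.toEuclideanLin (h : Matrix (Fin d) (Fin d) ℝ)) ≠ 0 := by
  rw [Matrix.toEuclideanLin_eq_toLin_orthonormal, LinearMap.det_toLin]
  exact (Matrix.isUnits_det_units h).ne_zero

theorem memLp_comp_affineInv (x : Space d) (h : GL (Fin d) ℝ) (f : L2 d) :
    MemLp (fun y => f (affineInv x h y)) 2 (volume : Measure (Space d)) := by
  have hm : Measurable (affineInv x h) := by
    have : Measurable (Matrix.toEuclideanLin
        ((h⁻¹ : GL (Fin d) ℝ) : Matrix (Fin d) (Fin d) ℝ)) :=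
      (LinearMap.continuous_of_finiteDimensional _).measurable
    exact this.comp (measurable_id.sub_const x)
  have hmap : Measure.map (affineInv x h) (volume : Measure (Space d)) =
      ENNReal.ofReal |(LinearMap.det (Matrix.toEuclideanLin
        ((h⁻¹ : GL (Fin d) ℝ) : Matrix (Fin d) (Fin d) ℝ)))⁻¹| • volume := by
    rw [← Measure.map_linearMap_addHaar_eq_smul_addHaar volume (det_toEuclideanLin_ne_zero h⁻¹)]
    have h1 : Measure.map (fun y : Space d => y - x) volume = volume :=
      (measurePreserving_sub_right volume x).map_eq
    conv_rhs => rw [← h1]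
    rw [Measure.map_map (LinearMap.continuous_of_finiteDimensional _).measurable
      (measurable_sub_const x)]
    rfl
  refine MemLp.comp_of_map (g := f) ?_ hm.aemeasurable
  rw [hmap]
  exact (Lp.memLp f).smul_measure ENNReal.ofReal_ne_top

/-- The quasi-regular representation of `G = ℝ^d ⋊ H` on `L²(ℝ^d)`:
`(π(x,h) f)(y) = |det h|^{-1/2} f(h⁻¹ (y - x))`. -/
def quasiRegular (x : Space d) (h : GL (Fin d) ℝ) (f : L2 d) : L2 d :=
  ((|(h : Matrix (Fin d) (Fin d) ℝ).det| ^ (-(1 / 2) : ℝ) : ℝ) : ℂ) •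
    (memLp_comp_affineInv x h f).toLp (fun y => f (affineInv x h y))

/-- The wavelet transform `(W_ψ f)(x,h) = ⟨f, π(x,h) ψ⟩`, a function on `G = ℝ^d ⋊ H`; the inner
product is linear in `f` (Mathlib's `inner` is conjugate-linear in its first argument). -/
def wavelet (H : Subgroup (GL (Fin d) ℝ)) (ψ f : L2 d) (p : Space d × H) : ℂ :=
  inner ℂ (quasiRegular p.1 (p.2 : GL (Fin d) ℝ) ψ) f

/-- The left Haar measure `dx dh / |det h|` of `G = ℝ^d ⋊ H`, where `dh = μ` is a left Haar
measure on `H`. -/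
def haarG (H : Subgroup (GL (Fin d) ℝ)) [MeasurableSpace H] (μ : Measure H) :
    Measure (Space d × H) :=
  (volume : Measure (Space d)).prod (μ.withDensity fun h =>
    ENNReal.ofReal |((h : GL (Fin d) ℝ) : Matrix (Fin d) (Fin d) ℝ).det|⁻¹)

section Spaces

variable (H : Subgroup (GL (Fin d) ℝ)) [MeasurableSpace H] (μ : Measure H) (w : H → ℝ)

/-- Membership in `L¹_w(G)`, where `w` is extended to `G` by `w(x,h) = w(h)`. -/
def MemL1 (F : Space d × H → ℂ) : Prop :=
  Integrable (fun p => (w p.2 : ℂ) * F p) (haarG H μ)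

/-- The set `A_w` of analyzing vectors. -/
def analyzing : Set (L2 d) := {ψ | MemL1 H μ w (wavelet H ψ ψ)}

/-- `{f ∈ L²(ℝ^d) : W_ψ f ∈ L¹_w(G)}` as a linear subspace of `L²(ℝ^d)`. -/
def H1Submodule (ψ : L2 d) : Submodule ℂ (L2 d) where
  carrier := {f | MemL1 H μ w (wavelet H ψ f)}
  zero_mem' := by
    simp [MemL1, wavelet]
  add_mem' {f g} hf hg := by
    have := Integrable.add hf hg
    refine this.congr (Filter.Eventually.of_forall fun p => ?_)
    simp [wavelet, inner_add_right, mul_add]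
  smul_mem' c f hf := by
    have := Integrable.const_mul hf c
    refine this.congr (Filter.Eventually.of_forall fun p => ?_)
    simp only [wavelet, inner_smul_right]
    ring

/-- The space `H¹_w`. This is a type of its own (and not a subtype of `L²(ℝ^d)`) because it
carries the norm `‖f‖ = ‖W_ψ f‖_{L¹_w(G)}` instead of the norm of `L²(ℝ^d)`. -/
@[ext]
structure H1 (ψ : L2 d) : Type where
  /-- The underlying element of `L²(ℝ^d)`. -/
  val : L2 d
  property : val ∈ H1Submodule H μ w ψ

namespace H1

variable {H μ w} {ψ : L2 d}

/-- The tautological bijection with the subspace of `L²(ℝ^d)`. -/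
def equiv : H1 H μ w ψ ≃ H1Submodule H μ w ψ where
  toFun f := ⟨f.val, f.property⟩
  invFun f := ⟨f.1, f.2⟩
  left_inv _ := rfl
  right_inv _ := rfl

instance : AddCommGroup (H1 H μ w ψ) := equiv.addCommGroup

instance : Module ℂ (H1 H μ w ψ) := equiv.module ℂ

theorem val_add (f g : H1 H μ w ψ) : (f + g).val = f.val + g.val := rfl

theorem val_smul (c : ℂ) (f : H1 H μ w ψ) : (c • f).val = c • f.val := rfl

/-- `‖f‖_{H¹_w} = ‖W_ψ f‖_{L¹_w(G)}`. -/
def seminorm : Seminorm ℂ (H1 H μ w ψ) :=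
  Seminorm.of (fun f => ∫ p, ‖(w p.2 : ℂ) * wavelet H ψ f.val p‖ ∂(haarG H μ))
    (fun f g => by
      have hf : Integrable _ (haarG H μ) := f.property
      have hg : Integrable _ (haarG H μ) := g.property
      rw [← integral_add hf.norm hg.norm]
      have hfg : Integrable _ (haarG H μ) := (f + g).property
      refine integral_mono hfg.norm (hf.norm.add hg.norm) fun p => ?_
      simp only [val_add, wavelet, inner_add_right, mul_add]
      exact norm_add_le _ _)
    (fun c f => by
      rw [← integral_const_mul]
      refine integral_congr_ae (Filter.Eventually.of_forall fun p => ?_)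
      simp only [val_smul, wavelet, inner_smul_right, norm_mul]
      ring)

instance : SeminormedAddCommGroup (H1 H μ w ψ) :=
  (seminorm (H := H) (μ := μ) (w := w) (ψ := ψ)).toAddGroupSeminorm.toSeminormedAddCommGroup

theorem norm_def (f : H1 H μ w ψ) :
    ‖f‖ = ∫ p, ‖(w p.2 : ℂ) * wavelet H ψ f.val p‖ ∂(haarG H μ) := rfl

instance : NormedSpace ℂ (H1 H μ w ψ) where
  norm_smul_le c f := (map_smul_eq_mul (seminorm (H := H) (μ := μ) (w := w) (ψ := ψ)) c f).le

end H1

/-- The reservoir `(H¹_w)^¬`: the bounded antilinear functionals on `H¹_w`, with the weak-*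
topology (pointwise convergence on `H¹_w`). -/
abbrev Reservoir (ψ : L2 d) : Type :=
  PointwiseConvergenceCLM (starRingEnd ℂ) (H1 H μ w ψ) ℂ

end Spaces

/-- The space `D'(U)` of complex distributions on the open set `U`: the continuous complex-linear
functionals on `D(U) = C_c^∞(U; ℂ)` (with its usual LF topology), with the topology of pointwise
convergence on `D(U)`. -/
abbrev Distr (U : TopologicalSpace.Opens (Space d)) : Type :=
  PointwiseConvergenceCLM (RingHom.id ℂ) 𝓓(U, ℂ) ℂ

/-- The complex conjugate of a test function. -/
def conjTest {U : TopologicalSpace.Opens (Space d)} (g : 𝓓(U, ℂ)) : 𝓓(U, ℂ) :=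
  TestFunction.postcompCLM (Complex.conjCLE : ℂ →L[ℝ] ℂ) g

theorem conjTest_apply {U : TopologicalSpace.Opens (Space d)} (g : 𝓓(U, ℂ)) (x : Space d) :
    conjTest g x = starRingEnd ℂ (g x) := by
  simp [conjTest]

/-- The inverse Fourier transform `x ↦ ∫ g(ξ) e^{2πi⟨x,ξ⟩} dξ` of a test function, as an element
of `L²(ℝ^d)`. -/
def fourierInvTest {U : TopologicalSpace.Opens (Space d)} (g : 𝓓(U, ℂ)) : L2 d :=
  (𝓕⁻ (g.hasCompactSupport.toSchwartzMap g.contDiff)).toLp 2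

end WaveletCoorbit

end

/-! By Plancherel everything moves to the Fourier side. There π(x,h) becomes `hatRep`, that is, φ ↦
|det h|^{1/2} e^{-2πi⟨x,ξ⟩} φ(h^T ξ), the wavelet transform becomes `hatW`, and the norm of H¹_w
becomes `weightedNorm`. Write φ = 𝓕ψ.

The engine is a weighted Young inequality (`weightedNorm_le_of_integral_rep`). If γ is a
superposition ∫ s(x) π(P(x)) β dx, then W_φ γ(q) = ∫ s(x) W_φ β(P(x)⁻¹q) dx. Left invariance of Haar
measure and submultiplicativity of w then bound the norm of γ by ∫ |s| w(P) times the norm of β.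

Compactness of the isotropy group makes the action on the orbit proper, and left invariance makes
∫_H F(k^T ξ) dk independent of ξ in the orbit. Since φ ≠ 0, some real test function T has ∫ T(k^T ξ)
φ(k^T ξ) dk = c₀ ≠ 0 on the whole orbit (`exists_test_integral_ne_zero`). This T serves twice.

Membership and continuity (`exists_weightedNorm_test_le`): for g supported in a compact K, g(ξ) =
c₀⁻¹ ∫_C g(ξ) T(k^T ξ) φ(k^T ξ) dk with C compact. Writing g and T as Fourier integrals turns this
into a superposition of vectors π(p)φ. Hence ‖𝓕⁻¹g‖ in H¹_w is at most a constant depending on K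
times ‖𝓕⁻¹g‖_{L¹}, which is continuous in g on each 𝓓_K.

Injectivity: test functions are dense in H¹_w (`exists_test_weightedNorm_sub_le`). The vector T
reproduces: γ = c⁻¹ ∫_G W_φ γ(p) π(p)T dp weakly, where c is the conjugate of c₀. Truncating to a
compact E ⊂ G gives a test function on the orbit, and Young's inequality bounds the error by the
L¹_w tail of W_φ γ off E. A functional vanishing on all 𝓕⁻¹g is therefore zero. -/

noncomputable section

namespace WaveletCoorbit

/-! ### Matrices acting on ℝ^d and on its dual; topology of H. -/

section

variable {d : ℕ}

/-- The linear map `x ↦ h x` of `ℝ^d`. -/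
def lin (h : GL (Fin d) ℝ) : Space d →L[ℝ] Space d :=
  Matrix.toEuclideanCLM (𝕜 := ℝ) (h : Matrix (Fin d) (Fin d) ℝ)

/-- The linear map `ξ ↦ h^T ξ` of `ℝ^d`. -/
def dual (h : GL (Fin d) ℝ) : Space d →L[ℝ] Space d :=
  Matrix.toEuclideanCLM (𝕜 := ℝ) (h : Matrix (Fin d) (Fin d) ℝ).transpose

/-- The modulus `|det h|`. -/
def adet (h : GL (Fin d) ℝ) : ℝ := |(h : Matrix (Fin d) (Fin d) ℝ).det|

theorem lin_mul (g h : GL (Fin d) ℝ) (x : Space d) : lin (g * h) x = lin g (lin h x) := by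
  simp [lin]

theorem lin_one (x : Space d) : lin (1 : GL (Fin d) ℝ) x = x := by simp [lin]

theorem dual_mul (g h : GL (Fin d) ℝ) (x : Space d) : dual (g * h) x = dual h (dual g x) := by
  simp [dual, Matrix.transpose_mul]

theorem dual_one (x : Space d) : dual (1 : GL (Fin d) ℝ) x = x := by simp [dual]

theorem dual_inv_dual (h : GL (Fin d) ℝ) (x : Space d) : dual h⁻¹ (dual h x) = x := by
  rw [← dual_mul, mul_inv_cancel, dual_one]

theorem dual_dual_inv (h : GL (Fin d) ℝ) (x : Space d) : dual h (dual h⁻¹ x) = x := by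
  rw [← dual_mul, inv_mul_cancel, dual_one]

theorem lin_inv_lin (h : GL (Fin d) ℝ) (x : Space d) : lin h⁻¹ (lin h x) = x := by
  rw [← lin_mul, inv_mul_cancel, lin_one]

theorem lin_lin_inv (h : GL (Fin d) ℝ) (x : Space d) : lin h (lin h⁻¹ x) = x := by
  rw [← lin_mul, mul_inv_cancel, lin_one]

theorem inner_lin_left (h : GL (Fin d) ℝ) (x y : Space d) :
    inner ℝ (lin h x) y = inner ℝ x (dual h y) := by
  have : dual h = ContinuousLinearMap.adjoint (lin h) := by
    rw [← ContinuousLinearMap.star_eq_adjoint, lin, dual, ← map_star, Matrix.star_eq_conjTranspose,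
      Matrix.conjTranspose_eq_transpose_of_trivial]
  rw [this, ContinuousLinearMap.adjoint_inner_right]

theorem adet_pos (h : GL (Fin d) ℝ) : 0 < adet h :=
  abs_pos.2 (Matrix.isUnits_det_units h).ne_zero

theorem adet_mul (g h : GL (Fin d) ℝ) : adet (g * h) = adet g * adet h := by
  simp [adet, abs_mul]

theorem adet_inv (h : GL (Fin d) ℝ) : adet h⁻¹ = (adet h)⁻¹ := by
  refine eq_inv_of_mul_eq_one_left ?_
  rw [← adet_mul, inv_mul_cancel]
  simp [adet]

theorem continuous_coe_GL : Continuous fun h : GL (Fin d) ℝ => (h : Matrix (Fin d) (Fin d) ℝ) :=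
  Units.continuous_val

theorem continuous_adet : Continuous (adet : GL (Fin d) ℝ → ℝ) :=
  (continuous_coe_GL.matrix_det).abs

theorem continuous_lin : Continuous (lin : GL (Fin d) ℝ → Space d →L[ℝ] Space d) := by
  have : Continuous (Matrix.toEuclideanCLM (𝕜 := ℝ) (n := Fin d)) :=
    LinearMap.continuous_of_finiteDimensional (IsLinearMap.mk'
      (Matrix.toEuclideanCLM (𝕜 := ℝ) (n := Fin d)) ⟨map_add _, map_smul _⟩)
  exact this.comp continuous_coe_GL

theorem continuous_dual : Continuous (dual : GL (Fin d) ℝ → Space d →L[ℝ] Space d) := by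
  have : Continuous (Matrix.toEuclideanCLM (𝕜 := ℝ) (n := Fin d)) :=
    LinearMap.continuous_of_finiteDimensional (IsLinearMap.mk'
      (Matrix.toEuclideanCLM (𝕜 := ℝ) (n := Fin d)) ⟨map_add _, map_smul _⟩)
  exact this.comp continuous_coe_GL.matrix_transpose

theorem map_lin_volume (h : GL (Fin d) ℝ) :
    Measure.map (lin h) (volume : Measure (Space d)) = ENNReal.ofReal (adet h)⁻¹ • volume := by
  have hd : LinearMap.det (Matrix.toEuclideanLin (h : Matrix (Fin d) (Fin d) ℝ)) =
      (h : Matrix (Fin d) (Fin d) ℝ).det := by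
    rw [Matrix.toEuclideanLin_eq_toLin_orthonormal, LinearMap.det_toLin]
  have := Measure.map_linearMap_addHaar_eq_smul_addHaar (volume : Measure (Space d))
    (det_toEuclideanLin_ne_zero h)
  rwa [hd, abs_inv] at this

theorem map_dual_volume (h : GL (Fin d) ℝ) :
    Measure.map (dual h) (volume : Measure (Space d)) = ENNReal.ofReal (adet h)⁻¹ • volume := by
  have hd : LinearMap.det (Matrix.toEuclideanLin (h : Matrix (Fin d) (Fin d) ℝ).transpose) =
      (h : Matrix (Fin d) (Fin d) ℝ).det := by
    rw [Matrix.toEuclideanLin_eq_toLin_orthonormal, LinearMap.det_toLin, Matrix.det_transpose]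
  have hne : LinearMap.det (Matrix.toEuclideanLin (h : Matrix (Fin d) (Fin d) ℝ).transpose) ≠ 0 := by
    rw [hd]; exact (Matrix.isUnits_det_units h).ne_zero
  have := Measure.map_linearMap_addHaar_eq_smul_addHaar (volume : Measure (Space d)) hne
  rwa [hd, abs_inv] at this

/-- `ξ ↦ h^T ξ` as a homeomorphism. -/
def dualHomeo (h : GL (Fin d) ℝ) : Space d ≃ₜ Space d where
  toFun := dual h
  invFun := dual h⁻¹
  left_inv := dual_inv_dual h
  right_inv := dual_dual_inv h
  continuous_toFun := (dual h).continuous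
  continuous_invFun := (dual h⁻¹).continuous

/-- `x ↦ h x` as a homeomorphism. -/
def linHomeo (h : GL (Fin d) ℝ) : Space d ≃ₜ Space d where
  toFun := lin h
  invFun := lin h⁻¹
  left_inv := lin_inv_lin h
  right_inv := lin_lin_inv h
  continuous_toFun := (lin h).continuous
  continuous_invFun := (lin h⁻¹).continuous

theorem lintegral_comp_dual (h : GL (Fin d) ℝ) (f : Space d → ℝ≥0∞) :
    ∫⁻ ξ, f (dual h ξ) = ENNReal.ofReal (adet h)⁻¹ * ∫⁻ ξ, f ξ := by
  rw [← smul_eq_mul, ← lintegral_smul_measure, ← map_dual_volume]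
  exact ((dualHomeo h).measurableEmbedding.lintegral_map f).symm

theorem integral_comp_dual (h : GL (Fin d) ℝ) (f : Space d → ℂ) :
    ∫ ξ, f (dual h ξ) = ((adet h)⁻¹ : ℝ) * ∫ ξ, f ξ := by
  have := ((dualHomeo h).measurableEmbedding.integral_map (μ := volume) f)
  change ∫ y, f y ∂(Measure.map (dual h) volume) = ∫ x, f (dual h x) at this
  rw [← this, map_dual_volume, integral_smul_measure,
    ENNReal.toReal_ofReal (inv_nonneg.2 (adet_pos h).le)]
  simp

theorem integral_comp_lin (h : GL (Fin d) ℝ) (f : Space d → ℂ) :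
    ∫ ξ, f (lin h ξ) = ((adet h)⁻¹ : ℝ) * ∫ ξ, f ξ := by
  have := ((linHomeo h).measurableEmbedding.integral_map (μ := volume) f)
  change ∫ y, f y ∂(Measure.map (lin h) volume) = ∫ x, f (lin h x) at this
  rw [← this, map_lin_volume, integral_smul_measure,
    ENNReal.toReal_ofReal (inv_nonneg.2 (adet_pos h).le)]
  simp

theorem lintegral_comp_lin (h : GL (Fin d) ℝ) (f : Space d → ℝ≥0∞) :
    ∫⁻ ξ, f (lin h ξ) = ENNReal.ofReal (adet h)⁻¹ * ∫⁻ ξ, f ξ := by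
  rw [← smul_eq_mul, ← lintegral_smul_measure, ← map_lin_volume]
  exact ((linHomeo h).measurableEmbedding.lintegral_map f).symm

theorem quasiMeasurePreserving_dual (h : GL (Fin d) ℝ) :
    Measure.QuasiMeasurePreserving (dual h) (volume : Measure (Space d)) volume :=
  ⟨(dual h).continuous.measurable, by
    rw [map_dual_volume]; exact Measure.smul_absolutelyContinuous⟩

instance secondCountableTopology_GL : SecondCountableTopology (GL (Fin d) ℝ) := by
  have : SecondCountableTopology (Matrix (Fin d) (Fin d) ℝ) :=
    inferInstanceAs (SecondCountableTopology (Fin d → Fin d → ℝ))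
  have : SecondCountableTopology (Matrix (Fin d) (Fin d) ℝ)ᵐᵒᵖ :=
    MulOpposite.opHomeomorph.symm.isEmbedding.secondCountableTopology
  exact Units.isEmbedding_embedProduct.secondCountableTopology

instance secondCountableTopology_subgroup (H : Subgroup (GL (Fin d) ℝ)) :
    SecondCountableTopology H :=
  (Topology.IsEmbedding.subtypeVal (p := fun h => h ∈ H)).secondCountableTopology

theorem locallyCompactSpace_of_isClosed {H : Subgroup (GL (Fin d) ℝ)}
    (hH : IsClosed (H : Set (GL (Fin d) ℝ))) : LocallyCompactSpace H := by
  have h0 : LocallyCompactSpace (Matrix (Fin d) (Fin d) ℝ) :=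
    inferInstanceAs (LocallyCompactSpace (Fin d → Fin d → ℝ))
  have : LocallyCompactSpace (GL (Fin d) ℝ) :=
    Units.isClosedEmbedding_embedProduct.locallyCompactSpace
  exact hH.isClosedEmbedding_subtypeVal.locallyCompactSpace

variable {H : Subgroup (GL (Fin d) ℝ)} {ξ₀ : Space d}

theorem mem_dualOrbit {ξ : Space d} :
    ξ ∈ dualOrbit H ξ₀ ↔ ∃ h : H, dual (h : GL (Fin d) ℝ) ξ₀ = ξ := Iff.rfl

theorem mem_isotropy {h : H} : h ∈ isotropy H ξ₀ ↔ dual (h : GL (Fin d) ℝ) ξ₀ = ξ₀ := Iff.rfl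

theorem affineInv_eq (x : Space d) (h : GL (Fin d) ℝ) :
    affineInv x h = fun y => lin h⁻¹ (y - x) := rfl

theorem adet_def (h : GL (Fin d) ℝ) : adet h = |(h : Matrix (Fin d) (Fin d) ℝ).det| := rfl

attribute [irreducible] lin dual adet

end

/-! ### The quasi-regular representation and the wavelet transform on the Fourier side. -/

section

variable {d : ℕ}

/-- The character `t ↦ e^{2πit}`, with values in `ℂ`. -/
def chr (t : ℝ) : ℂ := ((𝐞 t : Circle) : ℂ)

theorem norm_chr (t : ℝ) : ‖chr t‖ = 1 := Circle.norm_coe _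

theorem chr_add (s t : ℝ) : chr (s + t) = chr s * chr t := by
  rw [chr, AddChar.map_add_eq_mul, Circle.coe_mul]
  rfl

theorem conj_chr (t : ℝ) : starRingEnd ℂ (chr t) = chr (-t) := by
  rw [chr, chr, AddChar.map_neg_eq_inv, Circle.coe_inv_eq_conj]

theorem fourierChar_smul (t : ℝ) (z : ℂ) : 𝐞 t • z = chr t * z := rfl

theorem contDiff_chr : ContDiff ℝ ⊤ chr := by
  have : chr = fun t : ℝ => Complex.exp (2 * Real.pi * t * Complex.I) := by
    funext t
    simp [chr, Real.fourierChar_apply]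
  rw [this]
  exact Complex.contDiff_exp.comp ((contDiff_const.mul Complex.ofRealCLM.contDiff).mul
    contDiff_const)

@[fun_prop]
theorem continuous_chr : Continuous chr := contDiff_chr.continuous

/-- The quasi-regular representation on the Fourier side:
`ξ ↦ |det h|^{1/2} e^{-2πi⟨x,ξ⟩} φ(h^T ξ)`. -/
def hatRep (x : Space d) (h : GL (Fin d) ℝ) (φ : Space d → ℂ) (ξ : Space d) : ℂ :=
  (√(adet h) : ℂ) * chr (-inner ℝ x ξ) * φ (dual h ξ)

/-- The map is Lipschitz: S scales L² norms by r^{1/2} and the multiplier costs at most C. It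
applies both to `quasiRegular` and to `hatRep`, whose continuity is needed for a density argument.
-/
theorem continuous_of_ae_eq_weightedComp {T : L2 d → L2 d} {S : Space d → Space d}
    (hS : Measurable S) {r : ℝ≥0∞} (hr : r ≠ ∞) (hmap : Measure.map S volume = r • volume)
    {m : Space d → ℂ} {C : ℝ} (hm : ∀ ξ, ‖m ξ‖ ≤ C)
    (hT : ∀ v, T v =ᵐ[volume] fun ξ => m ξ * v (S ξ)) : Continuous T := by
  have hC : 0 ≤ C := (norm_nonneg _).trans (hm 0)
  have key : ∀ v w, ‖T v - T w‖ ≤ (C * (r ^ (1 / 2 : ℝ)).toReal) * ‖v - w‖ := by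
    intro v w
    have h1 : ⇑(T v - T w) =ᵐ[volume] fun ξ => m ξ * ((v - w : L2 d) (S ξ)) := by
      have hq : Measure.QuasiMeasurePreserving S (volume : Measure (Space d)) volume :=
        ⟨hS, by rw [hmap]; exact Measure.smul_absolutelyContinuous⟩
      filter_upwards [Lp.coeFn_sub (T v) (T w), hT v, hT w, hq.ae (Lp.coeFn_sub v w)]
        with ξ h1 h2 h3 h4
      rw [h1, h4, Pi.sub_apply, Pi.sub_apply, h2, h3]
      ring
    have h2 : eLpNorm (T v - T w) 2 volume ≤
        ENNReal.ofReal C * (r ^ (1 / 2 : ℝ) * eLpNorm (v - w : L2 d) 2 volume) := by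
      rw [eLpNorm_congr_ae h1]
      have h3 : eLpNorm ((v - w : L2 d) ∘ S) 2 volume =
          r ^ (1 / 2 : ℝ) * eLpNorm (v - w : L2 d) 2 volume := by
        rw [← eLpNorm_map_measure (Lp.stronglyMeasurable _).aestronglyMeasurable hS.aemeasurable,
          hmap, eLpNorm_smul_measure_of_ne_top ENNReal.ofNat_ne_top]
        simp
      rw [← h3]
      refine eLpNorm_le_mul_eLpNorm_of_ae_le_mul (.of_forall fun ξ => ?_) _
      rw [norm_mul]
      exact mul_le_mul_of_nonneg_right (hm ξ) (norm_nonneg _)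
    rw [Lp.norm_def, Lp.norm_def, mul_assoc]
    refine (ENNReal.toReal_mono ?_ h2).trans_eq ?_
    · exact ENNReal.mul_ne_top ENNReal.ofReal_ne_top (ENNReal.mul_ne_top
        (ENNReal.rpow_ne_top_of_nonneg (by norm_num) hr) (Lp.eLpNorm_ne_top _))
    · rw [ENNReal.toReal_mul, ENNReal.toReal_mul, ENNReal.toReal_ofReal hC]
  refine LipschitzWith.continuous (K := ⟨C * (r ^ (1 / 2 : ℝ)).toReal, by positivity⟩) ?_
  refine LipschitzWith.of_dist_le_mul fun v w => ?_
  rw [dist_eq_norm, dist_eq_norm]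
  exact key v w

theorem map_affineInv (x : Space d) (h : GL (Fin d) ℝ) :
    Measure.map (affineInv x h) (volume : Measure (Space d)) =
      ENNReal.ofReal (adet h) • volume := by
  rw [affineInv_eq]
  have h1 : Measure.map (fun y : Space d => y - x) volume = volume :=
    (measurePreserving_sub_right volume x).map_eq
  have h2 := map_lin_volume h⁻¹
  rw [adet_inv, inv_inv] at h2
  rw [← h2]
  conv_rhs => rw [← h1]
  rw [Measure.map_map (lin h⁻¹).continuous.measurable (measurable_sub_const x)]
  rfl

theorem measurable_affineInv (x : Space d) (h : GL (Fin d) ℝ) : Measurable (affineInv x h) :=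
  affineInv_eq x h ▸ (lin h⁻¹).continuous.measurable.comp (measurable_sub_const x)

theorem coeFn_quasiRegular (x : Space d) (h : GL (Fin d) ℝ) (v : L2 d) :
    quasiRegular x h v =ᵐ[volume] fun y => ((√(adet h))⁻¹ : ℂ) * v (affineInv x h y) := by
  have hc : (((|(h : Matrix (Fin d) (Fin d) ℝ).det| ^ (-(1 / 2) : ℝ) : ℝ) : ℂ)) =
      ((√(adet h))⁻¹ : ℂ) := by
    rw [Real.rpow_neg (abs_nonneg _), ← Real.sqrt_eq_rpow, Complex.ofReal_inv, adet_def]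
  rw [quasiRegular, hc]
  filter_upwards [Lp.coeFn_smul ((√(adet h))⁻¹ : ℂ) ((memLp_comp_affineInv x h v).toLp _),
    (memLp_comp_affineInv x h v).coeFn_toLp] with y h1 h2
  rw [h1, Pi.smul_apply, h2, smul_eq_mul]

theorem memLp_comp_dual (h : GL (Fin d) ℝ) {φ : Space d → ℂ} (hφ : MemLp φ 2 volume) :
    MemLp (fun ξ => φ (dual h ξ)) 2 volume := by
  refine MemLp.comp_of_map (g := φ) ?_ (dual h).continuous.aemeasurable
  rw [map_dual_volume]
  exact hφ.smul_measure ENNReal.ofReal_ne_top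

theorem norm_hatRep (x : Space d) (h : GL (Fin d) ℝ) (φ : Space d → ℂ) (ξ : Space d) :
    ‖hatRep x h φ ξ‖ = √(adet h) * ‖φ (dual h ξ)‖ := by
  simp [hatRep, norm_chr, abs_of_nonneg (Real.sqrt_nonneg _)]

theorem memLp_hatRep (x : Space d) (h : GL (Fin d) ℝ) {φ : Space d → ℂ} (hφ : MemLp φ 2 volume) :
    MemLp (hatRep x h φ) 2 volume := by
  have h1 := (memLp_comp_dual h hφ).const_mul (√(adet h) : ℂ)
  refine h1.of_le ?_ (.of_forall fun ξ => ?_)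
  · have h2 : Continuous fun ξ : Space d => (√(adet h) : ℂ) * chr (-inner ℝ x ξ) := by
      fun_prop
    exact h2.aestronglyMeasurable.mul (memLp_comp_dual h hφ).1
  · rw [norm_hatRep]
    simp [abs_of_nonneg (Real.sqrt_nonneg _)]

theorem hatRep_congr_ae (x : Space d) (h : GL (Fin d) ℝ) {φ φ' : Space d → ℂ}
    (hφ : φ =ᵐ[volume] φ') : hatRep x h φ =ᵐ[volume] hatRep x h φ' := by
  filter_upwards [(quasiMeasurePreserving_dual h).ae hφ] with ξ hξ
  rw [hatRep, hatRep, hξ]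

/-- `x ↦ h⁻¹ x` as a continuous linear equivalence. -/
def linInvEquiv (h : GL (Fin d) ℝ) : Space d ≃L[ℝ] Space d :=
  ContinuousLinearEquiv.equivOfInverse (lin h⁻¹) (lin h) (lin_lin_inv h) (lin_inv_lin h)

/-- The quasi-regular representation on Schwartz functions. -/
def schwartzRep (x : Space d) (h : GL (Fin d) ℝ) (v : SchwartzMap (Space d) ℂ) :
    SchwartzMap (Space d) ℂ :=
  ((√(adet h))⁻¹ : ℂ) • (SchwartzMap.compCLMOfContinuousLinearEquiv ℂ (linInvEquiv h)
    v).compSubConstCLM ℂ x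

theorem schwartzRep_apply (x : Space d) (h : GL (Fin d) ℝ) (v : SchwartzMap (Space d) ℂ)
    (y : Space d) : schwartzRep x h v y = ((√(adet h))⁻¹ : ℂ) * v (affineInv x h y) := by
  rw [affineInv_eq]
  rfl

theorem fourier_schwartzRep (x : Space d) (h : GL (Fin d) ℝ) (v : SchwartzMap (Space d) ℂ)
    (ξ : Space d) : 𝓕 (schwartzRep x h v) ξ = hatRep x h (𝓕 v : SchwartzMap (Space d) ℂ) ξ := by
  rw [SchwartzMap.fourier_coe, Real.fourier_eq]
  -- Substitute y ↦ hy + x. The translation yields the character; the Jacobian |det h| against |det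
  -- h|^{-1/2} leaves |det h|^{1/2}.
  have h1 : ∫ y, 𝐞 (-inner ℝ y ξ) • schwartzRep x h v y =
      ∫ y, 𝐞 (-inner ℝ (y + x) ξ) • schwartzRep x h v (y + x) :=
    (integral_add_right_eq_self (fun y => 𝐞 (-inner ℝ y ξ) • schwartzRep x h v y) x).symm
  have h2 := integral_comp_lin h
    (fun y => 𝐞 (-inner ℝ (y + x) ξ) • schwartzRep x h v (y + x))
  rw [h1]
  have h3 : ∀ y, 𝐞 (-inner ℝ (lin h y + x) ξ) • schwartzRep x h v (lin h y + x) =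
      (((√(adet h))⁻¹ : ℂ) * chr (-inner ℝ x ξ)) * (𝐞 (-inner ℝ y (dual h ξ)) • v y) := by
    intro y
    have h4 : affineInv x h (lin h y + x) = y := by
      simp only [affineInv_eq, add_sub_cancel_right, lin_inv_lin]
    rw [schwartzRep_apply, h4, inner_add_left, inner_lin_left, neg_add, fourierChar_smul,
      fourierChar_smul, chr_add]
    ring
  simp only [h3, integral_const_mul] at h2
  rw [hatRep, SchwartzMap.fourier_coe, Real.fourier_eq]
  have hpos : (√(adet h) : ℂ) ≠ 0 := by
    exact_mod_cast (Real.sqrt_pos.2 (adet_pos h)).ne'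
  have hsq : ((adet h : ℝ) : ℂ) = (√(adet h) : ℂ) * (√(adet h) : ℂ) := by
    rw [← Complex.ofReal_mul, Real.mul_self_sqrt (adet_pos h).le]
  rw [Complex.ofReal_inv, hsq, mul_inv, mul_assoc, mul_assoc (√(adet h) : ℂ)⁻¹] at h2
  have h5 := mul_left_cancel₀ (inv_ne_zero hpos) h2
  rw [mul_assoc, h5, mul_inv_cancel_left₀ hpos]

/-- Both sides are continuous in v and agree on Schwartz functions, which are dense in L². -/
theorem fourier_quasiRegular (x : Space d) (h : GL (Fin d) ℝ) (v : L2 d) :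
    (𝓕 (quasiRegular x h v) : L2 d) =ᵐ[volume] hatRep x h (𝓕 v : L2 d) := by
  let T : L2 d → L2 d := fun u => (memLp_hatRep x h (Lp.memLp u)).toLp _
  have hT : ∀ u, T u =ᵐ[volume] hatRep x h u := fun u => MemLp.coeFn_toLp _
  have hcT : Continuous T := by
    refine continuous_of_ae_eq_weightedComp (dual h).continuous.measurable ENNReal.ofReal_ne_top
      (map_dual_volume h) (m := fun ξ => (√(adet h) : ℂ) * chr (-inner ℝ x ξ))
      (C := √(adet h)) (fun ξ => ?_) hT
    simp [norm_chr, abs_of_nonneg (Real.sqrt_nonneg _)]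
  have hcq : Continuous (quasiRegular x h : L2 d → L2 d) := by
    refine continuous_of_ae_eq_weightedComp (measurable_affineInv x h) ENNReal.ofReal_ne_top
      (map_affineInv x h) (m := fun _ => ((√(adet h))⁻¹ : ℂ)) (fun ξ => le_rfl)
      (coeFn_quasiRegular x h)
  have hF : Continuous (𝓕 : L2 d → L2 d) := (Lp.fourierTransformₗᵢ (Space d) ℂ).continuous
  have key : 𝓕 (quasiRegular x h v) = T (𝓕 v) := by
    refine DenseRange.induction_on (p := fun v : L2 d => 𝓕 (quasiRegular x h v) = T (𝓕 v))
      (SchwartzMap.denseRange_toLpCLM (p := 2) ENNReal.ofNat_ne_top) v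
      (isClosed_eq (hF.comp hcq) (hcT.comp hF)) fun s => ?_
    simp only [SchwartzMap.toLpCLM_apply, SchwartzMap.toLp_fourier_eq]
    have h1 : quasiRegular x h (s.toLp 2) = (schwartzRep x h s).toLp 2 := by
      refine Lp.ext ?_
      have hq : Measure.QuasiMeasurePreserving (affineInv x h)
          (volume : Measure (Space d)) volume :=
        ⟨measurable_affineInv x h, by
          rw [map_affineInv]; exact Measure.smul_absolutelyContinuous⟩
      filter_upwards [coeFn_quasiRegular x h (s.toLp 2), (schwartzRep x h s).coeFn_toLp 2,
        hq.ae (s.coeFn_toLp 2 volume)] with y h1 h2 h3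
      rw [h1, h2, h3, schwartzRep_apply]
    rw [h1, SchwartzMap.toLp_fourier_eq]
    refine Lp.ext ?_
    filter_upwards [(𝓕 (schwartzRep x h s)).coeFn_toLp 2, hT ((𝓕 s).toLp 2),
      hatRep_congr_ae x h ((𝓕 s).coeFn_toLp 2)] with ξ h1 h2 h3
    rw [h1, h2, h3]
    exact fourier_schwartzRep x h s ξ
  rw [key]
  exact hT _

/-- The wavelet transform on the Fourier side: the pairing of `β` with `hatRep x h α`. -/
def hatW (α β : Space d → ℂ) (x : Space d) (h : GL (Fin d) ℝ) : ℂ :=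
  ∫ ξ, β ξ * starRingEnd ℂ (hatRep x h α ξ)

theorem wavelet_eq_hatW (H : Subgroup (GL (Fin d) ℝ)) (ψ f : L2 d) (p : Space d × H) :
    wavelet H ψ f p = hatW (𝓕 ψ : L2 d) (𝓕 f : L2 d) p.1 p.2 := by
  rw [wavelet, ← Lp.inner_fourier_eq, L2.inner_def, hatW]
  refine integral_congr_ae ?_
  filter_upwards [fourier_quasiRegular p.1 (p.2 : GL (Fin d) ℝ) ψ] with ξ hξ
  rw [hξ]
  rfl

theorem hatW_congr_ae (α : Space d → ℂ) {β β' : Space d → ℂ} (h : β =ᵐ[volume] β') :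
    hatW α β = hatW α β' := by
  funext x k
  refine integral_congr_ae ?_
  filter_upwards [h] with ξ hξ
  rw [hξ]

/-- Covariance: ⟨π(p)β, π(q)α⟩ = ⟨β, π(p⁻¹q)α⟩. The substitution η = k^T ξ proves it for arbitrary
functions, without integrability. -/
theorem integral_hatRep_mul_conj (α β : Space d → ℂ) (x y : Space d) (k l : GL (Fin d) ℝ) :
    ∫ ξ, hatRep y k β ξ * starRingEnd ℂ (hatRep x l α ξ) =
      hatW α β (lin k⁻¹ (x - y)) (k⁻¹ * l) := by
  have h1 := integral_comp_dual k
    (fun η => β η * starRingEnd ℂ (hatRep (lin k⁻¹ (x - y)) (k⁻¹ * l) α η))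
  have hk : (√(adet k) : ℂ) ≠ 0 := by
    exact_mod_cast (Real.sqrt_pos.2 (adet_pos k)).ne'
  have hsq : ((adet k : ℝ) : ℂ) = (√(adet k) : ℂ) * (√(adet k) : ℂ) := by
    rw [← Complex.ofReal_mul, Real.mul_self_sqrt (adet_pos k).le]
  have h2 : hatW α β (lin k⁻¹ (x - y)) (k⁻¹ * l) = (adet k : ℂ) *
      ∫ ξ, β (dual k ξ) *
        starRingEnd ℂ (hatRep (lin k⁻¹ (x - y)) (k⁻¹ * l) α (dual k ξ)) := by
    rw [h1, hatW, ← mul_assoc, ← Complex.ofReal_mul, mul_inv_cancel₀ (adet_pos k).ne',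
      Complex.ofReal_one, one_mul]
  rw [h2, ← integral_const_mul]
  refine integral_congr_ae (.of_forall fun ξ => ?_)
  have h3 : dual (k⁻¹ * l) (dual k ξ) = dual l ξ := by
    rw [← dual_mul, mul_inv_cancel_left]
  have h4 : inner ℝ (lin k⁻¹ (x - y)) (dual k ξ) = inner ℝ x ξ - inner ℝ y ξ := by
    rw [← inner_lin_left, lin_lin_inv, inner_sub_left]
  have h5 : (√(adet (k⁻¹ * l)) : ℂ) = (√(adet k) : ℂ)⁻¹ * (√(adet l) : ℂ) := by
    rw [adet_mul, adet_inv, Real.sqrt_mul (inv_nonneg.2 (adet_pos k).le), Real.sqrt_inv]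
    push_cast
    rfl
  simp only [hatRep, h3, h4, h5, neg_sub, map_mul, hsq]
  simp only [conj_chr, neg_neg, sub_eq_add_neg, chr_add, map_mul, map_inv₀, Complex.conj_ofReal]
  field_simp

attribute [irreducible] chr

end

/-! ### Haar measure of G and the weighted Young inequality. -/

section

variable {d : ℕ} {H : Subgroup (GL (Fin d) ℝ)}

/-- The element `p⁻¹ q` of `G = ℝ^d ⋊ H`. -/
def invMul (p q : Space d × H) : Space d × H :=
  (lin ((p.2 : GL (Fin d) ℝ)⁻¹) (q.1 - p.1), p.2⁻¹ * q.2)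

theorem hatW_invMul (α β : Space d → ℂ) (p q : Space d × H) :
    hatW α β (invMul p q).1 (invMul p q).2 =
      ∫ ξ, hatRep p.1 p.2 β ξ * starRingEnd ℂ (hatRep q.1 q.2 α ξ) :=
  (integral_hatRep_mul_conj α β q.1 p.1 p.2 q.2).symm

theorem continuous_dual_apply :
    Continuous fun z : H × Space d => dual (z.1 : GL (Fin d) ℝ) z.2 :=
  (continuous_dual.comp (continuous_subtype_val.comp continuous_fst)).clm_apply continuous_snd

theorem continuous_lin_apply :
    Continuous fun z : H × Space d => lin (z.1 : GL (Fin d) ℝ) z.2 :=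
  (continuous_lin.comp (continuous_subtype_val.comp continuous_fst)).clm_apply continuous_snd

theorem continuous_adet_coe : Continuous fun h : H => adet (h : GL (Fin d) ℝ) :=
  continuous_adet.comp continuous_subtype_val

theorem continuous_invMul : Continuous fun z : (Space d × H) × (Space d × H) =>
    invMul z.1 z.2 := by
  have h1 : Continuous fun z : (Space d × H) × (Space d × H) =>
      lin ((z.1.2 : GL (Fin d) ℝ)⁻¹) (z.2.1 - z.1.1) :=
    (continuous_lin.comp (continuous_subtype_val.comp continuous_fst.snd).inv).clm_apply
      (continuous_snd.fst.sub continuous_fst.fst)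
  exact h1.prodMk (continuous_fst.snd.inv.mul continuous_snd.snd)

variable [MeasurableSpace H] [BorelSpace H]

theorem measurable_invMul_comp {X : Type*} [MeasurableSpace X] {P Q : X → Space d × H}
    (hP : Measurable P) (hQ : Measurable Q) : Measurable fun x => invMul (P x) (Q x) := by
  have h : Measurable fun z : (Space d × H) × (Space d × H) => invMul z.1 z.2 :=
    continuous_invMul.measurable
  have h2 : Measurable fun x => (P x, Q x) := hP.prodMk hQ
  have h3 := h.comp h2
  exact h3

theorem measurable_hatRep {φ : Space d → ℂ} (hφ : Measurable φ) :
    Measurable fun z : (Space d × H) × Space d => hatRep z.1.1 z.1.2 φ z.2 := by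
  have h1 : Measurable fun z : (Space d × H) × Space d =>
      dual (z.1.2 : GL (Fin d) ℝ) z.2 :=
    (continuous_dual_apply.comp (continuous_fst.snd.prodMk continuous_snd)).measurable
  have h2 : Measurable fun z : (Space d × H) × Space d =>
      (√(adet (z.1.2 : GL (Fin d) ℝ)) : ℂ) * chr (-inner ℝ z.1.1 z.2) := by
    have h3 : Continuous fun z : (Space d × H) × Space d => adet (z.1.2 : GL (Fin d) ℝ) :=
      continuous_adet_coe.comp continuous_fst.snd
    exact ((Complex.continuous_ofReal.comp h3.sqrt).mul (continuous_chr.comp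
      (continuous_fst.fst.inner continuous_snd).neg)).measurable
  exact h2.mul (hφ.comp h1)

theorem measurable_hatW {α β : Space d → ℂ} (hα : Measurable α) (hβ : Measurable β) :
    Measurable fun p : Space d × H => hatW α β p.1 p.2 := by
  have h1 : Measurable fun z : (Space d × H) × Space d =>
      β z.2 * starRingEnd ℂ (hatRep z.1.1 z.1.2 α z.2) :=
    (hβ.comp measurable_snd).mul (Complex.continuous_conj.measurable.comp (measurable_hatRep hα))
  exact (h1.stronglyMeasurable.integral_prod_right' (ν := volume)).measurable

theorem measurable_density : Measurable fun h : H =>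
    ENNReal.ofReal |((h : GL (Fin d) ℝ) : Matrix (Fin d) (Fin d) ℝ).det|⁻¹ := by
  have h := (continuous_adet_coe (H := H).measurable.inv).ennreal_ofReal
  simp only [adet_def] at h
  exact h

variable (μ : Measure H)

instance [SFinite μ] : SFinite (haarG H μ) := by
  unfold haarG
  infer_instance

theorem lintegral_haarG [SFinite μ] {F : Space d × H → ℝ≥0∞} (hF : Measurable F) :
    ∫⁻ p, F p ∂(haarG H μ) =
      ∫⁻ h : H, ENNReal.ofReal (adet (h : GL (Fin d) ℝ))⁻¹ * (∫⁻ x, F (x, h)) ∂μ := by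
  rw [haarG, lintegral_prod_symm _ hF.aemeasurable,
    lintegral_withDensity_eq_lintegral_mul μ measurable_density hF.lintegral_prod_left']
  simp only [adet_def]
  rfl

/-- Left invariance of `haarG`: the Jacobian of the dilation by the inverse of `p.2` is absorbed by
the density 1/|det h| once the H-variable is shifted. -/
theorem lintegral_invMul [SFinite μ] [μ.IsMulLeftInvariant] {F : Space d × H → ℝ≥0∞}
    (hF : Measurable F) (p : Space d × H) :
    ∫⁻ q, F (invMul p q) ∂(haarG H μ) = ∫⁻ q, F q ∂(haarG H μ) := by
  have hm : Measurable fun q : Space d × H => F (invMul p q) :=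
    hF.comp (measurable_invMul_comp measurable_const measurable_id)
  rw [lintegral_haarG μ hm, lintegral_haarG μ hF,
    ← lintegral_mul_left_eq_self (μ := μ) (fun h : H => ENNReal.ofReal (adet (h : GL (Fin d) ℝ))⁻¹ *
      ∫⁻ x, F (x, h)) p.2⁻¹]
  refine lintegral_congr fun l => ?_
  have h1 : ∫⁻ x, F (invMul p (x, l)) = ENNReal.ofReal (adet (p.2 : GL (Fin d) ℝ)) *
      ∫⁻ x, F (x, p.2⁻¹ * l) := by
    have h2 := lintegral_comp_lin (p.2 : GL (Fin d) ℝ)⁻¹ (fun x => F (x, p.2⁻¹ * l))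
    rw [adet_inv, inv_inv] at h2
    rw [← h2]
    exact lintegral_sub_right_eq_self (fun x => F (lin (p.2 : GL (Fin d) ℝ)⁻¹ x, p.2⁻¹ * l)) p.1
  rw [h1, ← mul_assoc, ← ENNReal.ofReal_mul (inv_nonneg.2 (adet_pos _).le)]
  congr 2
  rw [Subgroup.coe_mul, Subgroup.coe_inv, adet_mul, adet_inv, mul_inv, inv_inv, mul_comm]

/-- The `L¹_w(G)` norm on the Fourier side, as an extended nonnegative number. -/
def weightedNorm (w : H → ℝ) (α β : Space d → ℂ) : ℝ≥0∞ :=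
  ∫⁻ q, ENNReal.ofReal (w q.2) * ‖hatW α β q.1 q.2‖ₑ ∂(haarG H μ)

omit [BorelSpace H] in
theorem weight_le_weight_mul_invMul {w : H → ℝ} (hw : IsWeight H w) (p q : Space d × H) :
    ENNReal.ofReal (w q.2) ≤ ENNReal.ofReal (w p.2) * ENNReal.ofReal (w (invMul p q).2) := by
  have h1 : w q.2 ≤ w p.2 * w (invMul p q).2 := by
    have := hw.submultiplicative p.2 (p.2⁻¹ * q.2)
    rwa [mul_inv_cancel_left] at this
  rw [← ENNReal.ofReal_mul (hw.pos _).le]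
  exact ENNReal.ofReal_le_ofReal h1

theorem lintegral_weight_mul_invMul_le [SFinite μ] [μ.IsMulLeftInvariant] {w : H → ℝ}
    (hw : IsWeight H w) {B : Space d × H → ℝ≥0∞} (hB : Measurable B) (c : ℝ≥0∞)
    (p : Space d × H) :
    ∫⁻ q, ENNReal.ofReal (w q.2) * (c * B (invMul p q)) ∂(haarG H μ) ≤
      c * ENNReal.ofReal (w p.2) * ∫⁻ q, ENNReal.ofReal (w q.2) * B q ∂(haarG H μ) := by
  have hm : Measurable fun q : Space d × H => ENNReal.ofReal (w q.2) * B q :=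
    (hw.measurable.comp measurable_snd).ennreal_ofReal.mul hB
  rw [← lintegral_invMul μ hm p, ← lintegral_const_mul]
  · refine lintegral_mono fun q => ?_
    calc ENNReal.ofReal (w q.2) * (c * B (invMul p q))
        ≤ (ENNReal.ofReal (w p.2) * ENNReal.ofReal (w (invMul p q).2)) *
          (c * B (invMul p q)) := mul_le_mul_left (weight_le_weight_mul_invMul hw p q) _
      _ = _ := by ring
  · exact hm.comp (measurable_invMul_comp measurable_const measurable_id)

/-- Tonelli reduces this to one translate at a time, where w(q) ≤ w(p) w(p⁻¹q) and left invariance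
apply. -/
theorem lintegral_weight_mul_convolution_le [SFinite μ] [μ.IsMulLeftInvariant] {w : H → ℝ}
    (hw : IsWeight H w) {X : Type*} [MeasurableSpace X] {ν : Measure X} [SFinite ν]
    {s : X → ℝ≥0∞} (hs : Measurable s) {P : X → Space d × H} (hP : Measurable P)
    {B : Space d × H → ℝ≥0∞} (hB : Measurable B) :
    ∫⁻ q, ENNReal.ofReal (w q.2) * (∫⁻ x, s x * B (invMul (P x) q) ∂ν) ∂(haarG H μ) ≤
      (∫⁻ x, s x * ENNReal.ofReal (w (P x).2) ∂ν) *
        ∫⁻ q, ENNReal.ofReal (w q.2) * B q ∂(haarG H μ) := by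
  have hwm : Measurable fun q : Space d × H => ENNReal.ofReal (w q.2) :=
    (hw.measurable.comp measurable_snd).ennreal_ofReal
  have hinv : Measurable fun z : (Space d × H) × X => B (invMul (P z.2) z.1) :=
    hB.comp (measurable_invMul_comp (hP.comp measurable_snd) measurable_fst)
  have hm : Measurable fun z : (Space d × H) × X => s z.2 * B (invMul (P z.2) z.1) :=
    (hs.comp measurable_snd).mul hinv
  have hm2 : Measurable fun z : (Space d × H) × X =>
      ENNReal.ofReal (w z.1.2) * (s z.2 * B (invMul (P z.2) z.1)) :=
    (hwm.comp measurable_fst).mul hm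
  have h1 : ∀ q : Space d × H,
      ENNReal.ofReal (w q.2) * (∫⁻ x, s x * B (invMul (P x) q) ∂ν) =
        ∫⁻ x, ENNReal.ofReal (w q.2) * (s x * B (invMul (P x) q)) ∂ν := fun q =>
    (lintegral_const_mul _ (hm.comp measurable_prodMk_left)).symm
  rw [lintegral_congr h1, lintegral_lintegral_swap hm2.aemeasurable,
    ← lintegral_mul_const _ (show Measurable fun x => s x * ENNReal.ofReal (w (P x).2) from
      hs.mul (hwm.comp hP))]
  exact lintegral_mono fun x => lintegral_weight_mul_invMul_le μ hw hB (s x) (P x)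

/-- If F is not integrable the right side is ∞. An integral formula therefore has to be checked only
where its integral converges absolutely. -/
theorem enorm_le_lintegral_of_integrable_imp {X : Type*} [MeasurableSpace X] {ν : Measure X}
    {F : X → ℂ} (hF : AEStronglyMeasurable F ν) {z : ℂ} (h : Integrable F ν → z = ∫ x, F x ∂ν) :
    ‖z‖ₑ ≤ ∫⁻ x, ‖F x‖ₑ ∂ν := by
  by_cases hi : Integrable F ν
  · rw [h hi]
    exact enorm_integral_le_lintegral_enorm _
  · have : ∫⁻ x, ‖F x‖ₑ ∂ν = ∞ := by
      by_contra hne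
      exact hi ⟨hF, lt_top_iff_ne_top.2 hne⟩
    rw [this]
    exact le_top

/-- The common source of the norm bound for test functions and of the truncation error estimate. The
second use relies on `hrep` being conditional on integrability. -/
theorem weightedNorm_le_of_integral_rep [SFinite μ] [μ.IsMulLeftInvariant] {w : H → ℝ}
    (hw : IsWeight H w) {X : Type*} [MeasurableSpace X] {ν : Measure X} [SFinite ν]
    {s : X → ℂ} (hs : Measurable s) {P : X → Space d × H} (hP : Measurable P)
    {α β γ : Space d → ℂ} (hα : Measurable α) (hβ : Measurable β)
    (hrep : ∀ q : Space d × H,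
      Integrable (fun x => s x * hatW α β (invMul (P x) q).1 (invMul (P x) q).2) ν →
      hatW α γ q.1 q.2 = ∫ x, s x * hatW α β (invMul (P x) q).1 (invMul (P x) q).2 ∂ν) :
    weightedNorm μ w α γ ≤
      (∫⁻ x, ‖s x‖ₑ * ENNReal.ofReal (w (P x).2) ∂ν) * weightedNorm μ w α β := by
  have hB : Measurable fun p : Space d × H => hatW α β p.1 p.2 := measurable_hatW hα hβ
  refine le_trans ?_ (lintegral_weight_mul_convolution_le μ hw (ν := ν) hs.enorm hP hB.enorm)
  refine lintegral_mono fun q => mul_le_mul_right ?_ _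
  have hm : Measurable fun x : X =>
      s x * hatW α β (invMul (P x) q).1 (invMul (P x) q).2 :=
    hs.mul (hB.comp (measurable_invMul_comp hP measurable_const))
  refine (enorm_le_lintegral_of_integrable_imp hm.aestronglyMeasurable (hrep q)).trans_eq ?_
  exact lintegral_congr fun x => enorm_mul _ _

theorem enorm_mul_le_sq_add_sq (a b : ℂ) : ‖a * b‖ₑ ≤ ‖a‖ₑ ^ 2 + ‖b‖ₑ ^ 2 := by
  rw [enorm_mul]
  rcases le_total ‖a‖ₑ ‖b‖ₑ with h | h
  · exact (mul_le_mul_left h _).trans ((pow_two ‖b‖ₑ).symm.le.trans le_add_self)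
  · exact (mul_le_mul_right h _).trans ((pow_two ‖a‖ₑ).symm.le.trans le_self_add)

theorem lintegral_enorm_sq_lt_top {φ : Space d → ℂ} (hφ : MemLp φ 2 volume) :
    ∫⁻ ξ, ‖φ ξ‖ₑ ^ 2 < ∞ := by
  have := lintegral_rpow_enorm_lt_top_of_eLpNorm_lt_top two_ne_zero ENNReal.ofNat_ne_top hφ.2
  simpa using this

theorem lintegral_enorm_hatRep_sq (x : Space d) (h : GL (Fin d) ℝ) {φ : Space d → ℂ} :
    ∫⁻ ξ, ‖hatRep x h φ ξ‖ₑ ^ 2 = ∫⁻ ξ, ‖φ ξ‖ₑ ^ 2 := by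
  have h1 : ∀ ξ, ‖hatRep x h φ ξ‖ₑ ^ 2 = ENNReal.ofReal (adet h) * ‖φ (dual h ξ)‖ₑ ^ 2 := by
    intro ξ
    rw [← ofReal_norm, norm_hatRep, ENNReal.ofReal_mul (Real.sqrt_nonneg _), ofReal_norm, mul_pow,
      ← ENNReal.ofReal_pow (Real.sqrt_nonneg _), Real.sq_sqrt (adet_pos h).le]
  rw [lintegral_congr h1, lintegral_const_mul' _ _ ENNReal.ofReal_ne_top,
    lintegral_comp_dual h (fun ξ => ‖φ ξ‖ₑ ^ 2), ← mul_assoc, ← ENNReal.ofReal_mul (adet_pos h).le,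
    mul_inv_cancel₀ (adet_pos h).ne', ENNReal.ofReal_one, one_mul]

theorem integrable_mul_hatRep_mul_conj {X : Type*} [MeasurableSpace X] {ν : Measure X}
    [SFinite ν] {s : X → ℂ} (hs : Integrable s ν) {P : X → Space d × H} (hP : Measurable P)
    {β u : Space d → ℂ} (hβ : Measurable β) (hβ2 : MemLp β 2 volume) (hu : MemLp u 2 volume) :
    Integrable (fun z : X × Space d =>
      s z.1 * (hatRep (P z.1).1 (P z.1).2 β z.2 * starRingEnd ℂ (u z.2))) (ν.prod volume) := by
  have hm : AEStronglyMeasurable (fun z : X × Space d =>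
      s z.1 * (hatRep (P z.1).1 (P z.1).2 β z.2 * starRingEnd ℂ (u z.2))) (ν.prod volume) := by
    refine hs.1.comp_fst.mul (AEStronglyMeasurable.mul ?_ ?_)
    · exact ((measurable_hatRep hβ).comp
        ((hP.comp measurable_fst).prodMk measurable_snd)).aestronglyMeasurable
    · exact Complex.continuous_conj.comp_aestronglyMeasurable hu.1.comp_snd
  refine ⟨hm, ?_⟩
  rw [HasFiniteIntegral, lintegral_prod _ hm.enorm]
  -- The bound is uniform in x up to the factor |s x| because `hatRep` preserves the L² norm. Only
  -- finiteness matters, so |ab| ≤ |a|² + |b|² replaces Cauchy–Schwarz.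
  have hle : ∀ x, ∫⁻ ξ, ‖s x * (hatRep (P x).1 (P x).2 β ξ * starRingEnd ℂ (u ξ))‖ₑ ≤
      ‖s x‖ₑ * ((∫⁻ ξ, ‖β ξ‖ₑ ^ 2) + ∫⁻ ξ, ‖u ξ‖ₑ ^ 2) := by
    intro x
    rw [← lintegral_enorm_hatRep_sq (P x).1 (P x).2 (φ := β), ← lintegral_add_right'
      _ (hu.1.enorm.pow_const 2)]
    simp_rw [enorm_mul (s x)]
    rw [lintegral_const_mul' _ _ enorm_ne_top]
    gcongr with ξ
    have h3 := enorm_mul_le_sq_add_sq (hatRep (P x).1 (P x).2 β ξ) (starRingEnd ℂ (u ξ))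
    rwa [RCLike.enorm_conj] at h3
  refine (lintegral_mono hle).trans_lt ?_
  rw [lintegral_mul_const'' _ hs.1.enorm]
  exact ENNReal.mul_lt_top hs.2
    (ENNReal.add_lt_top.2 ⟨lintegral_enorm_sq_lt_top hβ2, lintegral_enorm_sq_lt_top hu⟩)

theorem integral_mul_pairing_eq {X : Type*} [MeasurableSpace X] {ν : Measure X}
    [SFinite ν] {s : X → ℂ} (hs : Integrable s ν) {P : X → Space d × H} (hP : Measurable P)
    {β γ u : Space d → ℂ} (hβ : Measurable β) (hβ2 : MemLp β 2 volume) (hu : MemLp u 2 volume)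
    (hγ : ∀ᵐ ξ, γ ξ = ∫ x, s x * hatRep (P x).1 (P x).2 β ξ ∂ν) :
    Integrable (fun x => s x * ∫ ξ, hatRep (P x).1 (P x).2 β ξ * starRingEnd ℂ (u ξ)) ν ∧
    ∫ ξ, γ ξ * starRingEnd ℂ (u ξ) =
      ∫ x, s x * (∫ ξ, hatRep (P x).1 (P x).2 β ξ * starRingEnd ℂ (u ξ)) ∂ν := by
  have hint := integrable_mul_hatRep_mul_conj hs hP hβ hβ2 hu
  constructor
  · have := hint.integral_prod_left
    simpa only [integral_const_mul] using this
  · have := integral_integral_swap (f := fun x ξ =>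
      s x * (hatRep (P x).1 (P x).2 β ξ * starRingEnd ℂ (u ξ))) hint
    simp only [integral_const_mul] at this
    rw [this]
    refine integral_congr_ae ?_
    filter_upwards [hγ] with ξ hξ
    rw [hξ, ← integral_mul_const]
    simp only [mul_assoc]

/-- Pair the superposition with u = π(q)α, exchange integrals by Fubini, and use covariance. -/
theorem hatW_eq_integral_of_ae_eq {X : Type*} [MeasurableSpace X] {ν : Measure X}
    [SFinite ν] {s : X → ℂ} (hs : Integrable s ν) {P : X → Space d × H} (hP : Measurable P)
    {α β γ : Space d → ℂ} (hα : MemLp α 2 volume) (hβ : Measurable β) (hβ2 : MemLp β 2 volume)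
    (hγ : ∀ᵐ ξ, γ ξ = ∫ x, s x * hatRep (P x).1 (P x).2 β ξ ∂ν) (q : Space d × H) :
    Integrable (fun x => s x * hatW α β (invMul (P x) q).1 (invMul (P x) q).2) ν ∧
    hatW α γ q.1 q.2 = ∫ x, s x * hatW α β (invMul (P x) q).1 (invMul (P x) q).2 ∂ν := by
  simp only [hatW_invMul]
  exact integral_mul_pairing_eq hs hP hβ hβ2 (memLp_hatRep q.1 q.2 hα) hγ

end

/-! ### The orbit map: openness, properness, and integrals along orbits. -/

section

variable {d : ℕ} {H : Subgroup (GL (Fin d) ℝ)} {ξ₀ : Space d}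

theorem dual_mem_dualOrbit (h : H) {ξ : Space d} (hξ : ξ ∈ dualOrbit H ξ₀) :
    dual (h : GL (Fin d) ℝ) ξ ∈ dualOrbit H ξ₀ := by
  obtain ⟨g, rfl⟩ := mem_dualOrbit.1 hξ
  exact mem_dualOrbit.2 ⟨g * h, dual_mul _ _ _⟩

/-- The left action `h • ξ = h^{-T} ξ` of `H` on the dual orbit. -/
abbrev orbitAction (H : Subgroup (GL (Fin d) ℝ)) (ξ₀ : Space d) :
    MulAction H (dualOrbit H ξ₀) where
  smul h ξ := ⟨dual ((h⁻¹ : H) : GL (Fin d) ℝ) ξ, dual_mem_dualOrbit _ ξ.2⟩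
  one_smul ξ := Subtype.ext (by
    change dual ((1⁻¹ : H) : GL (Fin d) ℝ) ξ = ξ
    rw [inv_one]
    exact dual_one _)
  mul_smul g h ξ := Subtype.ext (by
    change dual (((g * h)⁻¹ : H) : GL (Fin d) ℝ) (ξ : Space d) =
      dual ((g⁻¹ : H) : GL (Fin d) ℝ) (dual ((h⁻¹ : H) : GL (Fin d) ℝ) (ξ : Space d))
    rw [mul_inv_rev, Subgroup.coe_mul, dual_mul])

/-- Open mapping theorem for group actions: the σ-compact group H acts transitively on the orbit,
which is open in ℝ^d, hence locally compact and Baire. The inverse turns the right action h^T into a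
left one. -/
theorem isOpenMap_orbit (hH : IsAdmissible H ξ₀) :
    IsOpenMap fun h : H => dual ((h⁻¹ : H) : GL (Fin d) ℝ) ξ₀ := by
  let _ := orbitAction H ξ₀
  have : LocallyCompactSpace H := locallyCompactSpace_of_isClosed hH.isClosed
  have : LocallyCompactSpace (dualOrbit H ξ₀) := hH.isOpen_orbit.locallyCompactSpace
  have : ContinuousSMul H (dualOrbit H ξ₀) := ⟨by
    have h : Continuous fun z : H × dualOrbit H ξ₀ => (z.1⁻¹, (z.2 : Space d)) :=
      continuous_fst.inv.prodMk (continuous_subtype_val.comp continuous_snd)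
    have h2 := continuous_dual_apply.comp h
    exact h2.subtype_mk _⟩
  have hbase : ξ₀ ∈ dualOrbit H ξ₀ := mem_dualOrbit.2 ⟨1, dual_one _⟩
  have : MulAction.IsPretransitive H (dualOrbit H ξ₀) := by
    refine ⟨fun ξ η => ?_⟩
    obtain ⟨a, ha⟩ := mem_dualOrbit.1 ξ.2
    obtain ⟨b, hb⟩ := mem_dualOrbit.1 η.2
    refine ⟨b⁻¹ * a, Subtype.ext ?_⟩
    change dual (((b⁻¹ * a)⁻¹ : H) : GL (Fin d) ℝ) (ξ : Space d) = η
    rw [← ha, ← hb, ← dual_mul, ← Subgroup.coe_mul]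
    simp
  have h1 := isOpenMap_smul_of_sigmaCompact (G := H) (⟨ξ₀, hbase⟩ : dualOrbit H ξ₀)
  exact hH.isOpen_orbit.isOpenMap_subtype_val.comp h1

/-- By openness of the orbit map, images of compact neighbourhoods in H are neighbourhoods in the
orbit; finitely many cover K. -/
theorem exists_isCompact_lift (hH : IsAdmissible H ξ₀) {K : Set (Space d)} (hK : IsCompact K)
    (hKO : K ⊆ dualOrbit H ξ₀) :
    ∃ Q : Set H, IsCompact Q ∧ ∀ ξ ∈ K, ∃ h ∈ Q, dual (h : GL (Fin d) ℝ) ξ₀ = ξ := by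
  have : LocallyCompactSpace H := locallyCompactSpace_of_isClosed hH.isClosed
  refine hK.induction_on (p := fun K => ∃ Q : Set H, IsCompact Q ∧
    ∀ ξ ∈ K, ∃ h ∈ Q, dual (h : GL (Fin d) ℝ) ξ₀ = ξ) ⟨∅, isCompact_empty, by simp⟩ ?_ ?_ ?_
  · rintro s t hst ⟨Q, hQ, h⟩
    exact ⟨Q, hQ, fun ξ hξ => h ξ (hst hξ)⟩
  · rintro s t ⟨Q, hQ, h⟩ ⟨R, hR, h'⟩
    refine ⟨Q ∪ R, hQ.union hR, ?_⟩
    rintro ξ (hξ | hξ)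
    · obtain ⟨k, hk, e⟩ := h ξ hξ
      exact ⟨k, Or.inl hk, e⟩
    · obtain ⟨k, hk, e⟩ := h' ξ hξ
      exact ⟨k, Or.inr hk, e⟩
  · intro ξ hξ
    obtain ⟨g, rfl⟩ := mem_dualOrbit.1 (hKO hξ)
    obtain ⟨N, hN, hgN⟩ := exists_compact_mem_nhds g⁻¹
    have hnhds := (isOpenMap_orbit hH).image_mem_nhds hgN
    rw [inv_inv] at hnhds
    refine ⟨_, mem_nhdsWithin_of_mem_nhds hnhds, N⁻¹, hN.inv, ?_⟩
    rintro _ ⟨n, hn, rfl⟩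
    exact ⟨n⁻¹, by simpa using hn, rfl⟩

/-- Properness of the action. With ξ = q^T ξ₀ and k^T ξ = r^T ξ₀ for q, r in compact lifts, q k r⁻¹
fixes ξ₀, so k lies in Q⁻¹ · (isotropy) · R. -/
theorem exists_isCompact_transporter (hH : IsAdmissible H ξ₀) {K S : Set (Space d)}
    (hK : IsCompact K) (hKO : K ⊆ dualOrbit H ξ₀) (hS : IsCompact S)
    (hSO : S ⊆ dualOrbit H ξ₀) :
    ∃ C : Set H, IsCompact C ∧ ∀ k : H, ∀ ξ ∈ K, dual (k : GL (Fin d) ℝ) ξ ∈ S → k ∈ C := by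
  obtain ⟨Q, hQ, hQK⟩ := exists_isCompact_lift hH hK hKO
  obtain ⟨R, hR, hRS⟩ := exists_isCompact_lift hH hS hSO
  let m : H × H × H → H := fun z => z.1⁻¹ * z.2.1 * z.2.2
  have hm : Continuous m :=
    (continuous_fst.inv.mul continuous_snd.fst).mul continuous_snd.snd
  refine ⟨m '' (Q ×ˢ isotropy H ξ₀ ×ˢ R),
    (hQ.prod (hH.isCompact_isotropy.prod hR)).image hm, fun k ξ hξ hk => ?_⟩
  obtain ⟨q, hq, hqξ⟩ := hQK ξ hξ
  obtain ⟨r, hr, hrξ⟩ := hRS _ hk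
  refine ⟨(q, q * k * r⁻¹, r), ⟨hq, ?_, hr⟩, by simp [m, mul_assoc]⟩
  rw [mem_isotropy, Subgroup.coe_mul, Subgroup.coe_mul, dual_mul, dual_mul, hqξ, ← hrξ, Subgroup.coe_inv,
    dual_inv_dual]

variable [MeasurableSpace H] [BorelSpace H] (μ : Measure H)

/-- If ξ = g^T ξ₀ then k^T ξ = (gk)^T ξ₀, and left invariance removes g. -/
theorem integral_dual_eq_of_mem_dualOrbit {V : Type*} [NormedAddCommGroup V] [NormedSpace ℝ V]
    [μ.IsMulLeftInvariant] {F : Space d → V} {ξ : Space d}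
    (hξ : ξ ∈ dualOrbit H ξ₀) :
    ∫ k : H, F (dual (k : GL (Fin d) ℝ) ξ) ∂μ = ∫ k : H, F (dual (k : GL (Fin d) ℝ) ξ₀) ∂μ := by
  obtain ⟨g, rfl⟩ := mem_dualOrbit.1 hξ
  rw [← integral_mul_left_eq_self (fun k : H => F (dual (k : GL (Fin d) ℝ) ξ₀)) g]
  simp only [Subgroup.coe_mul, dual_mul]

theorem lintegral_dual_eq_of_mem_dualOrbit [μ.IsMulLeftInvariant] {F : Space d → ℝ≥0∞}
    {ξ : Space d} (hξ : ξ ∈ dualOrbit H ξ₀) :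
    ∫⁻ k : H, F (dual (k : GL (Fin d) ℝ) ξ) ∂μ =
      ∫⁻ k : H, F (dual (k : GL (Fin d) ℝ) ξ₀) ∂μ := by
  obtain ⟨g, rfl⟩ := mem_dualOrbit.1 hξ
  rw [← lintegral_mul_left_eq_self (fun k : H => F (dual (k : GL (Fin d) ℝ) ξ₀)) g]
  simp only [Subgroup.coe_mul, dual_mul]

omit [MeasurableSpace H] [BorelSpace H] in
theorem ae_mem_dualOrbit (hH : IsAdmissible H ξ₀) : ∀ᵐ ξ, ξ ∈ dualOrbit H ξ₀ := by
  rw [ae_iff]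
  exact hH.orbit_full

theorem measurable_comp_dual {φ : Space d → ℂ} (hφ : Measurable φ) :
    Measurable fun z : H × Space d => φ (dual (z.1 : GL (Fin d) ℝ) z.2) := by
  have h := continuous_dual_apply (H := H).measurable
  have h2 := hφ.comp h
  exact h2

/-- The point is that this holds for every ξ of the orbit although φ is merely L². Tonelli gives
finiteness for almost every η near ξ₀; one good η suffices, since left translation in H carries it
to any other point of the orbit. -/
theorem integrableOn_dual [μ.IsHaarMeasure] (hH : IsAdmissible H ξ₀) {φ : Space d → ℂ}
    (hφ : Measurable φ) (hφ2 : MemLp φ 2 volume) {ξ : Space d} (hξ : ξ ∈ dualOrbit H ξ₀)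
    {C : Set H} (hC : IsCompact C) :
    IntegrableOn (fun k : H => φ (dual (k : GL (Fin d) ℝ) ξ)) C μ := by
  have : LocallyCompactSpace H := locallyCompactSpace_of_isClosed hH.isClosed
  let E : CompactExhaustion H := CompactExhaustion.choice H
  have hball : ∀ n, ∫⁻ η in Metric.ball ξ₀ 1 ∩ dualOrbit H ξ₀,
      ∫⁻ k in E n, ‖φ (dual (k : GL (Fin d) ℝ) η)‖ₑ ∂μ < ∞ := by
    intro n
    have hm : Measurable fun z : Space d × H => ‖φ (dual (z.2 : GL (Fin d) ℝ) z.1)‖ₑ :=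
      ((measurable_comp_dual hφ).comp measurable_swap).enorm
    rw [lintegral_lintegral_swap hm.aemeasurable]
    have hle : ∀ k : H, ∫⁻ η in Metric.ball ξ₀ 1 ∩ dualOrbit H ξ₀,
        ‖φ (dual (k : GL (Fin d) ℝ) η)‖ₑ ≤ volume (Metric.ball ξ₀ 1) +
          ENNReal.ofReal (adet (k : GL (Fin d) ℝ))⁻¹ * ∫⁻ η, ‖φ η‖ₑ ^ 2 := by
      intro k
      have h1 : ∀ a : ℂ, ‖a‖ₑ ≤ 1 + ‖a‖ₑ ^ 2 := fun a => by
        have := enorm_mul_le_sq_add_sq 1 a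
        simpa using this
      calc _ ≤ ∫⁻ η in Metric.ball ξ₀ 1 ∩ dualOrbit H ξ₀,
            (1 + ‖φ (dual (k : GL (Fin d) ℝ) η)‖ₑ ^ 2) := lintegral_mono fun η => h1 _
        _ = volume (Metric.ball ξ₀ 1 ∩ dualOrbit H ξ₀) +
            ∫⁻ η in Metric.ball ξ₀ 1 ∩ dualOrbit H ξ₀, ‖φ (dual (k : GL (Fin d) ℝ) η)‖ₑ ^ 2 := by
              rw [lintegral_add_left measurable_const, setLIntegral_one]
        _ ≤ _ := by
          rw [← lintegral_comp_dual (k : GL (Fin d) ℝ) (fun η => ‖φ η‖ₑ ^ 2)]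
          exact add_le_add (measure_mono Set.inter_subset_left) (setLIntegral_le_lintegral _ _)
    obtain ⟨D, hD⟩ := (E.isCompact n).bddAbove_image
      (f := fun k : H => (adet (k : GL (Fin d) ℝ))⁻¹)
      (continuous_adet_coe.inv₀ fun k => (adet_pos _).ne').continuousOn
    have hle2 : ∫⁻ k in E n, (∫⁻ η in Metric.ball ξ₀ 1 ∩ dualOrbit H ξ₀,
        ‖φ (dual (k : GL (Fin d) ℝ) η)‖ₑ) ∂μ ≤ ∫⁻ _ in E n,
          (volume (Metric.ball ξ₀ 1) + ENNReal.ofReal D * ∫⁻ η, ‖φ η‖ₑ ^ 2) ∂μ := by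
      refine setLIntegral_mono' (E.isCompact n).measurableSet fun k hk => ?_
      refine (hle k).trans ?_
      gcongr
      exact hD ⟨k, hk, rfl⟩
    refine hle2.trans_lt ?_
    rw [setLIntegral_const]
    exact ENNReal.mul_lt_top (ENNReal.add_lt_top.2 ⟨measure_ball_lt_top,
      ENNReal.mul_lt_top ENNReal.ofReal_lt_top (lintegral_enorm_sq_lt_top hφ2)⟩)
      (E.isCompact n).measure_lt_top
  have hm : Measurable fun z : Space d × H => ‖φ (dual (z.2 : GL (Fin d) ℝ) z.1)‖ₑ :=
    ((measurable_comp_dual hφ).comp measurable_swap).enorm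
  have hae : ∀ᵐ η ∂(volume.restrict (Metric.ball ξ₀ 1 ∩ dualOrbit H ξ₀)), ∀ n,
      ∫⁻ k in E n, ‖φ (dual (k : GL (Fin d) ℝ) η)‖ₑ ∂μ < ∞ := by
    rw [ae_all_iff]
    intro n
    exact ae_lt_top hm.lintegral_prod_right' (hball n).ne
  have hbase : ξ₀ ∈ dualOrbit H ξ₀ := mem_dualOrbit.2 ⟨1, dual_one _⟩
  have hopen : IsOpen (Metric.ball ξ₀ 1 ∩ dualOrbit H ξ₀) :=
    Metric.isOpen_ball.inter hH.isOpen_orbit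
  have hne : volume.restrict (Metric.ball ξ₀ 1 ∩ dualOrbit H ξ₀) ≠ 0 := by
    rw [Ne, Measure.restrict_eq_zero]
    exact (hopen.measure_pos volume ⟨ξ₀, Metric.mem_ball_self one_pos, hbase⟩).ne'
  have : (ae (volume.restrict (Metric.ball ξ₀ 1 ∩ dualOrbit H ξ₀))).NeBot := ae_neBot.2 hne
  -- A good point exists because the open set ball ∩ orbit has positive measure. Translation by a⁻¹b
  -- then turns integrals at η = a^T ξ₀ into integrals at ξ = b^T ξ₀.
  obtain ⟨η, hη, hηO⟩ := (hae.and (ae_restrict_mem hopen.measurableSet)).exists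
  obtain ⟨a, rfl⟩ := mem_dualOrbit.1 hηO.2
  obtain ⟨b, rfl⟩ := mem_dualOrbit.1 hξ
  have hmk : Measurable fun k : H => φ (dual (k : GL (Fin d) ℝ) (dual (b : GL (Fin d) ℝ) ξ₀)) :=
    (measurable_comp_dual hφ).comp measurable_prodMk_right
  refine ⟨hmk.aestronglyMeasurable, ?_⟩
  have hC' : IsCompact ((fun k => a⁻¹ * b * k) '' C) := hC.image (continuous_const_mul _)
  obtain ⟨n, hn⟩ := E.exists_superset_of_isCompact hC'
  have hlt := hη n
  rw [HasFiniteIntegral]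
  refine lt_of_le_of_lt ?_ hlt
  have hCm : MeasurableSet C := hC.measurableSet
  rw [← lintegral_indicator hCm,
    ← lintegral_indicator (E.isCompact n).measurableSet,
    ← lintegral_mul_left_eq_self ((E n : Set H).indicator _) (a⁻¹ * b)]
  refine lintegral_mono fun k => ?_
  by_cases hk : k ∈ C
  · rw [Set.indicator_of_mem hk, Set.indicator_of_mem (hn ⟨k, hk, rfl⟩), ← dual_mul, ← dual_mul]
    simp [mul_assoc]
  · rw [Set.indicator_of_notMem hk]
    exact zero_le

end

/-! ### A test function whose orbit average against φ does not vanish. -/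

section

variable {d : ℕ} {H : Subgroup (GL (Fin d) ℝ)} {ξ₀ : Space d}

theorem continuous_dual_const (ξ : Space d) :
    Continuous fun k : H => dual (k : GL (Fin d) ℝ) ξ :=
  (continuous_dual.comp continuous_subtype_val).clm_apply continuous_const

/-- A test function, as a Schwartz function. -/
def testSchwartz {U : TopologicalSpace.Opens (Space d)} (g : 𝓓(U, ℂ)) :
    SchwartzMap (Space d) ℂ :=
  g.hasCompactSupport.toSchwartzMap g.contDiff

theorem testSchwartz_apply {U : TopologicalSpace.Opens (Space d)} (g : 𝓓(U, ℂ)) (ξ : Space d) :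
    testSchwartz g ξ = g ξ := rfl

theorem integral_chr_mul_fourierInv (g : SchwartzMap (Space d) ℂ) (ξ : Space d) :
    ∫ z, chr (-inner ℝ z ξ) * (𝓕⁻ g : SchwartzMap (Space d) ℂ) z = g ξ := by
  have h : 𝓕 (𝓕⁻ g : SchwartzMap (Space d) ℂ) = g := FourierTransform.fourier_fourierInv_eq g
  have h2 := congrArg (fun f : SchwartzMap (Space d) ℂ => f ξ) h
  rw [← h2, SchwartzMap.fourier_coe, Real.fourier_eq]
  simp only [fourierChar_smul]

theorem IsWeight.exists_le_of_isCompact [MeasurableSpace H] {w : H → ℝ} (hw : IsWeight H w)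
    {C : Set H} (hC : IsCompact C) : ∃ D : ℝ, ∀ k ∈ C, w k ≤ D := by
  refine hC.induction_on (p := fun C => ∃ D : ℝ, ∀ k ∈ C, w k ≤ D) ⟨0, by simp⟩ ?_ ?_ ?_
  · rintro s t hst ⟨D, hD⟩
    exact ⟨D, fun k hk => hD k (hst hk)⟩
  · rintro s t ⟨D, hD⟩ ⟨D', hD'⟩
    refine ⟨max D D', ?_⟩
    rintro k (hk | hk)
    · exact (hD k hk).trans (le_max_left _ _)
    · exact (hD' k hk).trans (le_max_right _ _)
  · intro k _
    obtain ⟨D, hD⟩ := hw.locallyBounded k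
    exact ⟨_, mem_nhdsWithin_of_mem_nhds hD, D, fun _ h => h⟩

variable [MeasurableSpace H] [BorelSpace H] (μ : Measure H)

theorem integrable_test_mul_dual [μ.IsHaarMeasure] (hH : IsAdmissible H ξ₀) {φ : Space d → ℂ}
    (hφ : Measurable φ) (hφ2 : MemLp φ 2 volume) (T : 𝓓(hH.orbit, ℂ)) {ξ : Space d}
    (hξ : ξ ∈ dualOrbit H ξ₀) :
    Integrable (fun k : H => T (dual (k : GL (Fin d) ℝ) ξ) * φ (dual (k : GL (Fin d) ℝ) ξ)) μ := by
  obtain ⟨C, hC, hCT⟩ := exists_isCompact_transporter hH (isCompact_singleton (x := ξ))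
    (Set.singleton_subset_iff.2 hξ) T.hasCompactSupport T.tsupport_subset
  have hTc : Continuous fun k : H => T (dual (k : GL (Fin d) ℝ) ξ) :=
    T.continuous.comp (continuous_dual_const ξ)
  have h1 := (integrableOn_dual μ hH hφ hφ2 hξ hC).continuousOn_mul hTc.continuousOn hC
  rw [integrableOn_iff_integrable_of_support_subset] at h1
  · exact h1
  · intro k hk
    by_contra hkC
    refine hk ?_
    have h2 : T (dual (k : GL (Fin d) ℝ) ξ) = 0 := by
      by_contra hne
      exact hkC (hCT k ξ rfl (subset_tsupport _ hne))
    simp [h2]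

/-- Preimages of compact sets under the orbit map lie in compact sets, where `integrableOn_dual`
applies. This allows the fundamental lemma of the calculus of variations for the pushforward of μ.
-/
theorem locallyIntegrableOn_map_orbit [μ.IsHaarMeasure] (hH : IsAdmissible H ξ₀)
    {φ : Space d → ℂ} (hφ : Measurable φ) (hφ2 : MemLp φ 2 volume)
    (hp : Measurable fun k : H => dual (k : GL (Fin d) ℝ) ξ₀) :
    LocallyIntegrableOn φ (dualOrbit H ξ₀)
      (μ.map fun k : H => dual (k : GL (Fin d) ℝ) ξ₀) := by
  have hbase : ξ₀ ∈ dualOrbit H ξ₀ := mem_dualOrbit.2 ⟨1, dual_one _⟩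
  intro x hx
  obtain ⟨N, hNx, hNO, hN⟩ := exists_compact_between (isCompact_singleton (x := x))
    hH.isOpen_orbit (Set.singleton_subset_iff.2 hx)
  obtain ⟨C, hC, hCN⟩ := exists_isCompact_transporter hH (isCompact_singleton (x := ξ₀))
    (Set.singleton_subset_iff.2 hbase) hNx hN
  refine ⟨N, mem_nhdsWithin_of_mem_nhds
    (mem_interior_iff_mem_nhds.1 (hNO rfl)), ?_⟩
  rw [IntegrableOn, Measure.restrict_map hp hNx.measurableSet,
    integrable_map_measure hφ.aestronglyMeasurable hp.aemeasurable]
  exact (integrableOn_dual μ hH hφ hφ2 hbase hC).mono_set fun k hk => hCN k ξ₀ rfl hk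

/-- Compares null sets of H with Lebesgue null sets. The integral of |φ(k^T ξ)| over k vanishes at
ξ₀, hence at every ξ of the orbit; exchanging the integrals gives a single k with φ ∘ k^T = 0 almost
everywhere, and k^T preserves null sets. -/
theorem ae_eq_zero_of_ae_dual_eq_zero [μ.IsHaarMeasure] (hH : IsAdmissible H ξ₀)
    {φ : Space d → ℂ} (hφ : Measurable φ)
    (h : ∀ᵐ k : H ∂μ, φ (dual (k : GL (Fin d) ℝ) ξ₀) = 0) : φ =ᵐ[volume] 0 := by
  have : LocallyCompactSpace H := locallyCompactSpace_of_isClosed hH.isClosed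
  have hm : Measurable fun z : Space d × H => ‖φ (dual (z.2 : GL (Fin d) ℝ) z.1)‖ₑ :=
    ((measurable_comp_dual hφ).comp measurable_swap).enorm
  have h0 : ∫⁻ ξ, ∫⁻ k : H, ‖φ (dual (k : GL (Fin d) ℝ) ξ)‖ₑ ∂μ = 0 := by
    rw [lintegral_eq_zero_iff hm.lintegral_prod_right']
    filter_upwards [ae_mem_dualOrbit hH] with ξ hξ
    rw [lintegral_dual_eq_of_mem_dualOrbit μ (F := fun η => ‖φ η‖ₑ) hξ, Pi.zero_apply,
      lintegral_eq_zero_iff (show Measurable fun k : H => ‖φ (dual (k : GL (Fin d) ℝ) ξ₀)‖ₑ from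
        (hφ.comp (continuous_dual_const ξ₀).measurable).enorm)]
    filter_upwards [h] with k hk
    simp [hk]
  rw [lintegral_lintegral_swap hm.aemeasurable, lintegral_eq_zero_iff hm.lintegral_prod_left'] at h0
  obtain ⟨k, hk⟩ := h0.exists
  simp only [Pi.zero_apply] at hk
  rw [lintegral_comp_dual (k : GL (Fin d) ℝ) (fun η => ‖φ η‖ₑ), mul_eq_zero] at hk
  have h1 : ENNReal.ofReal (adet (k : GL (Fin d) ℝ))⁻¹ ≠ 0 := by
    simpa using adet_pos (k : GL (Fin d) ℝ)
  have h2 := hk.resolve_left h1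
  rw [lintegral_eq_zero_iff hφ.enorm] at h2
  filter_upwards [h2] with ξ hξ
  simpa using hξ

/-- Otherwise φ would vanish almost everywhere for the pushforward of μ, hence for Lebesgue measure.
T comes from a real-valued function, so conjugation acts only on φ later. -/
theorem exists_test_integral_ne_zero [μ.IsHaarMeasure] (hH : IsAdmissible H ξ₀)
    {φ : Space d → ℂ} (hφ : Measurable φ) (hφ2 : MemLp φ 2 volume)
    (hφ0 : ¬ φ =ᵐ[volume] 0) :
    ∃ T : 𝓓(hH.orbit, ℂ), (∀ ξ, starRingEnd ℂ (T ξ) = T ξ) ∧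
      ∫ k : H, T (dual (k : GL (Fin d) ℝ) ξ₀) * φ (dual (k : GL (Fin d) ℝ) ξ₀) ∂μ ≠ 0 := by
  by_contra! hcon
  refine hφ0 (ae_eq_zero_of_ae_dual_eq_zero μ hH hφ ?_)
  have hp : Measurable fun k : H => dual (k : GL (Fin d) ℝ) ξ₀ :=
    (continuous_dual_const ξ₀).measurable
  have h1 := hH.isOpen_orbit.ae_eq_zero_of_integral_contDiff_smul_eq_zero
    (locallyIntegrableOn_map_orbit μ hH hφ hφ2 hp) (fun g hg hgc hgO => by
      rw [integral_map hp.aemeasurable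
        (show Measurable fun x => g x • φ x from
          hg.continuous.measurable.smul hφ).aestronglyMeasurable]
      have hsub : tsupport (fun ξ => (g ξ : ℂ)) ⊆ tsupport g :=
        tsupport_comp_subset Complex.ofReal_zero g
      exact hcon ⟨fun ξ => (g ξ : ℂ), Complex.ofRealCLM.contDiff.comp hg,
        hgc.comp_left Complex.ofReal_zero, hsub.trans hgO⟩ fun ξ => Complex.conj_ofReal _)
  filter_upwards [ae_of_ae_map hp.aemeasurable h1] with k hk
  exact hk (mem_dualOrbit.2 ⟨k, rfl⟩)

end

/-! ### Test functions as superpositions of π(p)φ, and their norm bound. -/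

section

variable {d : ℕ} {H : Subgroup (GL (Fin d) ℝ)} {ξ₀ : Space d}

theorem continuous_inv_sqrt_adet : Continuous fun k : H => (√(adet (k : GL (Fin d) ℝ)))⁻¹ :=
  continuous_adet_coe.sqrt.inv₀ fun _ => (Real.sqrt_pos.2 (adet_pos _)).ne'

theorem lintegral_weight_lt_top [MeasurableSpace H] [BorelSpace H] (μ : Measure H)
    [IsFiniteMeasureOnCompacts μ] {w : H → ℝ} (hw : IsWeight H w) {C : Set H} (hC : IsCompact C) :
    ∫⁻ k in C, ENNReal.ofReal (√(adet (k : GL (Fin d) ℝ)))⁻¹ * ENNReal.ofReal (w k) ∂μ < ∞ := by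
  obtain ⟨D, hD⟩ := hw.exists_le_of_isCompact hC
  obtain ⟨D', hD'⟩ := hC.bddAbove_image continuous_inv_sqrt_adet.continuousOn
  refine (setLIntegral_mono' (g := fun _ => ENNReal.ofReal D' * ENNReal.ofReal D) hC.measurableSet
    fun k hk => ?_).trans_lt ?_
  · exact mul_le_mul' (ENNReal.ofReal_le_ofReal (hD' ⟨k, hk, rfl⟩))
      (ENNReal.ofReal_le_ofReal (hD k hk))
  · rw [setLIntegral_const]
    exact ENNReal.mul_lt_top (ENNReal.mul_lt_top ENNReal.ofReal_lt_top ENNReal.ofReal_lt_top)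
      hC.measure_lt_top

/-- The product `(z, 1) (0, k) (y, 1)` in `G`, as a function of `(k, z, y)`. -/
def sandwich (x : H × Space d × Space d) : Space d × H :=
  (x.2.1 + lin (x.1 : GL (Fin d) ℝ) x.2.2, x.1)

theorem continuous_sandwich : Continuous (sandwich : H × Space d × Space d → Space d × H) := by
  have h := continuous_lin_apply.comp
    (continuous_fst.prodMk (continuous_snd.snd : Continuous fun x : H × Space d × Space d => _))
  exact (continuous_snd.fst.add h).prodMk continuous_fst

/-- The two translations produce one character in ξ and one in k^T ξ. Integrated against inverse
Fourier transforms they become multiplication by functions of ξ and of k^T ξ. -/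
theorem hatRep_sandwich (x : H × Space d × Space d) (φ : Space d → ℂ) (ξ : Space d) :
    ((√(adet (x.1 : GL (Fin d) ℝ)))⁻¹ : ℂ) * hatRep (sandwich x).1 (sandwich x).2 φ ξ =
      φ (dual (x.1 : GL (Fin d) ℝ) ξ) * (chr (-inner ℝ x.2.1 ξ) *
        chr (-inner ℝ x.2.2 (dual (x.1 : GL (Fin d) ℝ) ξ))) := by
  have hk : (√(adet (x.1 : GL (Fin d) ℝ)) : ℂ) ≠ 0 := by
    exact_mod_cast (Real.sqrt_pos.2 (adet_pos (x.1 : GL (Fin d) ℝ))).ne'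
  rw [hatRep, sandwich, inner_add_left, inner_lin_left, neg_add, chr_add]
  field_simp

/-- The coefficients in the expansion of `𝓕⁻ a` along the translates of an analyzing vector. -/
def sandwichCoeff (c : ℂ) (a b : Space d → ℂ) (x : H × Space d × Space d) : ℂ :=
  c * ((√(adet (x.1 : GL (Fin d) ℝ)))⁻¹ : ℂ) * (a x.2.1 * b x.2.2)

variable [MeasurableSpace H] [BorelSpace H] (μ : Measure H)

theorem measurable_sandwichCoeff (c : ℂ) {a b : Space d → ℂ} (ha : Measurable a)
    (hb : Measurable b) : Measurable (sandwichCoeff (H := H) c a b) := by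
  have h1 : Continuous fun x : H × Space d × Space d =>
      ((√(adet (x.1 : GL (Fin d) ℝ)))⁻¹ : ℂ) := by
    have := Complex.continuous_ofReal.comp (continuous_inv_sqrt_adet.comp
      (continuous_fst : Continuous fun x : H × Space d × Space d => x.1))
    simpa [Function.comp_def] using this
  exact (measurable_const.mul h1.measurable).mul
    ((ha.comp measurable_snd.fst).mul (hb.comp measurable_snd.snd))

theorem lintegral_sandwichCoeff_mul_weight [SFinite μ] {w : H → ℝ} (hw : IsWeight H w) (c : ℂ)
    {a b : Space d → ℂ} (ha : Measurable a) (hb : Measurable b) (C : Set H) :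
    ∫⁻ x, ‖sandwichCoeff c a b x‖ₑ * ENNReal.ofReal (w (sandwich x).2)
        ∂((μ.restrict C).prod (volume.prod volume)) =
      ‖c‖ₑ * (∫⁻ k in C, ENNReal.ofReal (√(adet (k : GL (Fin d) ℝ)))⁻¹ *
        ENNReal.ofReal (w k) ∂μ) * ((∫⁻ z, ‖a z‖ₑ) * ∫⁻ y, ‖b y‖ₑ) := by
  have h1 : ∀ x : H × Space d × Space d,
      ‖sandwichCoeff c a b x‖ₑ * ENNReal.ofReal (w (sandwich x).2) =
      (‖c‖ₑ * (ENNReal.ofReal (√(adet (x.1 : GL (Fin d) ℝ)))⁻¹ * ENNReal.ofReal (w x.1))) *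
        (‖a x.2.1‖ₑ * ‖b x.2.2‖ₑ) := by
    intro x
    have h2 : ‖((√(adet (x.1 : GL (Fin d) ℝ)))⁻¹ : ℂ)‖ₑ =
        ENNReal.ofReal (√(adet (x.1 : GL (Fin d) ℝ)))⁻¹ := by
      rw [← Complex.ofReal_inv, ← ofReal_norm, Complex.norm_real, Real.norm_of_nonneg
        (inv_nonneg.2 (Real.sqrt_nonneg _))]
    rw [sandwichCoeff, enorm_mul, enorm_mul, enorm_mul, h2, sandwich]
    ring
  have hm : Measurable fun k : H => ENNReal.ofReal (√(adet (k : GL (Fin d) ℝ)))⁻¹ *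
      ENNReal.ofReal (w k) :=
    continuous_inv_sqrt_adet.measurable.ennreal_ofReal.mul hw.measurable.ennreal_ofReal
  rw [lintegral_congr h1, lintegral_prod_mul (f := fun k : H => ‖c‖ₑ *
      (ENNReal.ofReal (√(adet (k : GL (Fin d) ℝ)))⁻¹ * ENNReal.ofReal (w k)))
      (g := fun z : Space d × Space d => ‖a z.1‖ₑ * ‖b z.2‖ₑ) (hm.const_mul _).aemeasurable
      ((ha.comp measurable_fst).enorm.mul (hb.comp measurable_snd).enorm).aemeasurable,
    lintegral_prod_mul ha.enorm.aemeasurable hb.enorm.aemeasurable, lintegral_const_mul _ hm]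

theorem integrable_sandwichCoeff [IsFiniteMeasureOnCompacts μ] (c : ℂ) {a b : Space d → ℂ}
    (ha : Integrable a) (hb : Integrable b) {C : Set H} (hC : IsCompact C) :
    Integrable (sandwichCoeff c a b) ((μ.restrict C).prod (volume.prod volume)) := by
  have h1 : Continuous fun k : H => c * ((√(adet (k : GL (Fin d) ℝ)))⁻¹ : ℂ) := by
    have := Complex.continuous_ofReal.comp (continuous_inv_sqrt_adet (H := H))
    exact continuous_const.mul (by simpa [Function.comp_def] using this)
  exact (h1.continuousOn.integrableOn_compact hC).mul_prod (ha.mul_prod hb)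

theorem integral_sandwichCoeff_mul_hatRep [SFinite μ] (c : ℂ)
    (S R : SchwartzMap (Space d) ℂ) {φ : Space d → ℂ} {C : Set H} {ξ : Space d}
    (hφ : IntegrableOn (fun k : H => φ (dual (k : GL (Fin d) ℝ) ξ)) C μ) :
    ∫ x, sandwichCoeff c (𝓕⁻ S : SchwartzMap (Space d) ℂ) (𝓕⁻ R : SchwartzMap (Space d) ℂ) x *
        hatRep (sandwich x).1 (sandwich x).2 φ ξ ∂((μ.restrict C).prod (volume.prod volume)) =
      c * S ξ * ∫ k in C, R (dual (k : GL (Fin d) ℝ) ξ) * φ (dual (k : GL (Fin d) ℝ) ξ) ∂μ := by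
  set s : SchwartzMap (Space d) ℂ := 𝓕⁻ S
  set r : SchwartzMap (Space d) ℂ := 𝓕⁻ R
  have h1 : ∀ x : H × Space d × Space d,
      sandwichCoeff c s r x * hatRep (sandwich x).1 (sandwich x).2 φ ξ =
      (c * φ (dual (x.1 : GL (Fin d) ℝ) ξ)) * ((chr (-inner ℝ x.2.1 ξ) * s x.2.1) *
        (chr (-inner ℝ x.2.2 (dual (x.1 : GL (Fin d) ℝ) ξ)) * r x.2.2)) := by
    intro x
    calc _ = c * (s x.2.1 * r x.2.2) * (((√(adet (x.1 : GL (Fin d) ℝ)))⁻¹ : ℂ) *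
          hatRep (sandwich x).1 (sandwich x).2 φ ξ) := by rw [sandwichCoeff]; ring
      _ = _ := by rw [hatRep_sandwich]; ring
  have hdom : Integrable (fun x : H × Space d × Space d =>
      (c * φ (dual (x.1 : GL (Fin d) ℝ) ξ)) * (s x.2.1 * r x.2.2))
      ((μ.restrict C).prod (volume.prod volume)) :=
    (hφ.const_mul c).mul_prod (s.integrable.mul_prod r.integrable)
  have hch : Continuous fun x : H × Space d × Space d =>
      chr (-inner ℝ x.2.1 ξ) * chr (-inner ℝ x.2.2 (dual (x.1 : GL (Fin d) ℝ) ξ)) := by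
    have h3 := (continuous_dual_const ξ).comp
      (continuous_fst : Continuous fun x : H × Space d × Space d => x.1)
    exact (continuous_chr.comp (continuous_snd.fst.inner continuous_const).neg).mul
      (continuous_chr.comp (continuous_snd.snd.inner h3).neg)
  have hint : Integrable (fun x : H × Space d × Space d =>
      (c * φ (dual (x.1 : GL (Fin d) ℝ) ξ)) * ((chr (-inner ℝ x.2.1 ξ) * s x.2.1) *
        (chr (-inner ℝ x.2.2 (dual (x.1 : GL (Fin d) ℝ) ξ)) * r x.2.2)))
      ((μ.restrict C).prod (volume.prod volume)) := by
    refine (hdom.mono (hch.aestronglyMeasurable.mul hdom.1) (.of_forall fun x => ?_)).congr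
      (.of_forall fun x => ?_)
    · simp [norm_chr]
    · simp only [Pi.mul_apply]
      ring
  rw [integral_congr_ae (.of_forall h1), integral_prod _ hint]
  have h2 : ∀ k : H, ∫ z : Space d × Space d, (c * φ (dual (k : GL (Fin d) ℝ) ξ)) *
      ((chr (-inner ℝ z.1 ξ) * s z.1) *
        (chr (-inner ℝ z.2 (dual (k : GL (Fin d) ℝ) ξ)) * r z.2)) ∂(volume.prod volume) =
      (c * S ξ) * (R (dual (k : GL (Fin d) ℝ) ξ) * φ (dual (k : GL (Fin d) ℝ) ξ)) := by
    intro k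
    rw [integral_const_mul, integral_prod_mul (fun z => chr (-inner ℝ z ξ) * s z)
      (fun y => chr (-inner ℝ y (dual (k : GL (Fin d) ℝ) ξ)) * r y),
      integral_chr_mul_fourierInv, integral_chr_mul_fourierInv]
    ring
  simp only [h2, integral_const_mul]

theorem exists_weightedNorm_test_le [μ.IsHaarMeasure] (hH : IsAdmissible H ξ₀) {w : H → ℝ}
    (hw : IsWeight H w) {φ : Space d → ℂ} (hφ : Measurable φ) (hφ2 : MemLp φ 2 volume)
    (hφ0 : ¬ φ =ᵐ[volume] 0) {K : Set (Space d)} (hK : IsCompact K) (hKO : K ⊆ dualOrbit H ξ₀) :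
    ∃ M : ℝ≥0∞, M ≠ ∞ ∧ ∀ g : 𝓓(hH.orbit, ℂ), Function.support g ⊆ K →
      weightedNorm μ w φ g ≤
        M * (∫⁻ x, ‖(𝓕⁻ (testSchwartz g) : SchwartzMap (Space d) ℂ) x‖ₑ) *
          weightedNorm μ w φ φ := by
  have : LocallyCompactSpace H := locallyCompactSpace_of_isClosed hH.isClosed
  obtain ⟨T, -, hT⟩ := exists_test_integral_ne_zero μ hH hφ hφ2 hφ0
  set c := ∫ k : H, T (dual (k : GL (Fin d) ℝ) ξ₀) * φ (dual (k : GL (Fin d) ℝ) ξ₀) ∂μ with hc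
  obtain ⟨C, hC, hCT⟩ := exists_isCompact_transporter hH hK hKO T.hasCompactSupport
    T.tsupport_subset
  set t : SchwartzMap (Space d) ℂ := 𝓕⁻ (testSchwartz T)
  -- This is the weighted L¹ norm of `sandwichCoeff` with the factor for g removed. It depends on K
  -- only through C, on which the weight is bounded.
  refine ⟨‖c⁻¹‖ₑ * (∫⁻ k in C, ENNReal.ofReal (√(adet (k : GL (Fin d) ℝ)))⁻¹ *
    ENNReal.ofReal (w k) ∂μ) * ∫⁻ y, ‖t y‖ₑ, ?_, fun g hg => ?_⟩
  · exact ENNReal.mul_ne_top (ENNReal.mul_ne_top enorm_ne_top (lintegral_weight_lt_top μ hw hC).ne)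
      t.integrable.2.ne
  set s : SchwartzMap (Space d) ℂ := 𝓕⁻ (testSchwartz g)
  have hrep : ∀ᵐ ξ, g ξ = ∫ x, sandwichCoeff c⁻¹ s t x * hatRep (sandwich x).1 (sandwich x).2 φ ξ
      ∂((μ.restrict C).prod (volume.prod volume)) := by
    filter_upwards [ae_mem_dualOrbit hH] with ξ hξ
    rw [integral_sandwichCoeff_mul_hatRep μ c⁻¹ (testSchwartz g) (testSchwartz T)
      (integrableOn_dual μ hH hφ hφ2 hξ hC), testSchwartz_apply]
    by_cases hgξ : g ξ = 0
    · simp [hgξ]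
    -- Where g(ξ) ≠ 0, ξ lies in K, so T(k^T ξ) vanishes for k outside C and the integral over C is
    -- the full orbit average c.
    · have h1 : ∫ k in C, testSchwartz T (dual (k : GL (Fin d) ℝ) ξ) *
          φ (dual (k : GL (Fin d) ℝ) ξ) ∂μ = c := by
        rw [hc, ← integral_dual_eq_of_mem_dualOrbit μ (F := fun η => T η * φ η) hξ]
        refine setIntegral_eq_integral_of_forall_compl_eq_zero fun k hk => ?_
        have h2 : T (dual (k : GL (Fin d) ℝ) ξ) = 0 := by
          by_contra hne
          exact hk (hCT k ξ (hg hgξ) (subset_tsupport _ hne))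
        rw [testSchwartz_apply, h2, zero_mul]
      rw [h1]
      field_simp
  have hmain := weightedNorm_le_of_integral_rep μ hw
    (ν := (μ.restrict C).prod ((volume : Measure (Space d)).prod (volume : Measure (Space d))))
    (measurable_sandwichCoeff (H := H) c⁻¹ s.continuous.measurable t.continuous.measurable)
    continuous_sandwich.measurable hφ hφ (γ := g) fun q _ =>
      (hatW_eq_integral_of_ae_eq (integrable_sandwichCoeff μ c⁻¹ s.integrable t.integrable hC)
        continuous_sandwich.measurable hφ2 hφ hφ2 hrep q).2
  rw [lintegral_sandwichCoeff_mul_weight μ hw c⁻¹ s.continuous.measurable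
    t.continuous.measurable] at hmain
  refine hmain.trans_eq ?_
  ring

end

/-! ### The weak reproducing formula. -/

section

variable {d : ℕ} {H : Subgroup (GL (Fin d) ℝ)} {ξ₀ : Space d}

theorem fourier_eq_integral_chr (f : Space d → ℂ) (w : Space d) :
    𝓕 f w = ∫ v, chr (-inner ℝ v w) * f v := by
  rw [Real.fourier_eq]
  simp only [fourierChar_smul]

theorem fourierInv_eq_integral_chr (f : Space d → ℂ) (w : Space d) :
    𝓕⁻ f w = ∫ v, chr (inner ℝ v w) * f v := by
  rw [Real.fourierInv_eq]
  simp only [fourierChar_smul]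

theorem integral_fourier_mul_eq {f g : Space d → ℂ} (hf : Integrable f) (hg : Integrable g) :
    ∫ ξ, 𝓕 f ξ * g ξ = ∫ x, f x * 𝓕 g x := by
  have h := VectorFourier.integral_fourierIntegral_smul_eq_flip (L := innerₗ (Space d))
    Real.continuous_fourierChar continuous_inner hf hg
  rw [flip_innerₗ] at h
  exact h

theorem integral_fourierInv_mul_eq {f g : Space d → ℂ} (hf : Integrable f)
    (hg : Integrable g) : ∫ ξ, 𝓕⁻ f ξ * g ξ = ∫ x, f x * 𝓕⁻ g x := by
  rw [Real.fourierInv_eq_fourier_comp_neg g, ← integral_fourier_mul_eq hf hg.comp_neg,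
    ← integral_neg_eq_self]
  simp only [Real.fourierInv_eq_fourier_neg, neg_neg]

/-- No continuity of a is available, so inversion is tested against smooth compactly supported
functions, onto which both transforms are moved. -/
theorem fourier_fourierInv_ae_eq {a : Space d → ℂ} (ha : Integrable a)
    (ha' : Integrable (𝓕⁻ a)) : 𝓕 (𝓕⁻ a) =ᵐ[volume] a := by
  have hc : Continuous (𝓕 (𝓕⁻ a)) :=
    VectorFourier.fourierIntegral_continuous Real.continuous_fourierChar continuous_inner ha'
  refine ae_eq_of_integral_contDiff_smul_eq hc.locallyIntegrable ha.locallyIntegrable ?_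
  intro g hg hgc
  let G : SchwartzMap (Space d) ℂ := (hgc.comp_left (g := Complex.ofReal)
    Complex.ofReal_zero).toSchwartzMap (Complex.ofRealCLM.contDiff.comp hg)
  have hG : ∀ ξ, G ξ = (g ξ : ℂ) := fun _ => rfl
  have h1 : ∫ ξ, 𝓕 (𝓕⁻ a) ξ * G ξ = ∫ ξ, a ξ * G ξ := by
    have h2 : Integrable (𝓕 (G : Space d → ℂ)) := by
      rw [← SchwartzMap.fourier_coe]
      exact SchwartzMap.integrable _
    rw [integral_fourier_mul_eq ha' G.integrable, integral_fourierInv_mul_eq ha h2]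
    have h3 : 𝓕⁻ (𝓕 (G : Space d → ℂ)) = G := by
      rw [← SchwartzMap.fourier_coe, ← SchwartzMap.fourierInv_coe]
      exact congrArg _ (FourierTransform.fourierInv_fourier_eq G)
    rw [h3]
  simpa only [hG, Complex.real_smul, mul_comm] using h1

theorem integral_fourierInv_mul_fourier {a b : Space d → ℂ} (ha : Integrable a)
    (ha' : Integrable (𝓕⁻ a)) (hb : Integrable b) :
    ∫ y, 𝓕⁻ a y * 𝓕 b y = ∫ ξ, a ξ * b ξ := by
  rw [← integral_fourier_mul_eq ha' hb]
  refine integral_congr_ae ?_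
  filter_upwards [fourier_fourierInv_ae_eq ha ha'] with ξ hξ
  rw [hξ]

theorem hatW_eq_fourierInv (φ γ : Space d → ℂ) (y : Space d) (k : GL (Fin d) ℝ) :
    hatW φ γ y k = (√(adet k) : ℂ) * 𝓕⁻ (fun ξ => γ ξ * starRingEnd ℂ (φ (dual k ξ))) y := by
  rw [fourierInv_eq_integral_chr, hatW, ← integral_const_mul]
  refine integral_congr_ae (.of_forall fun ξ => ?_)
  simp only [hatRep, map_mul, conj_chr, neg_neg, Complex.conj_ofReal, real_inner_comm]
  ring

theorem integral_hatRep_mul_conj_eq_fourier (τ u : Space d → ℂ) (y : Space d)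
    (k : GL (Fin d) ℝ) :
    ∫ ξ, hatRep y k τ ξ * starRingEnd ℂ (u ξ) =
      (√(adet k) : ℂ) * 𝓕 (fun ξ => τ (dual k ξ) * starRingEnd ℂ (u ξ)) y := by
  rw [fourier_eq_integral_chr, ← integral_const_mul]
  refine integral_congr_ae (.of_forall fun ξ => ?_)
  simp only [hatRep, real_inner_comm]
  ring

theorem memLp_conj {u : Space d → ℂ} (hu : MemLp u 2 volume) :
    MemLp (fun ξ => starRingEnd ℂ (u ξ)) 2 volume :=
  hu.of_le (Complex.continuous_conj.comp_aestronglyMeasurable hu.1) (.of_forall fun ξ => by simp)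

/-- For a fixed dilation k both factors are Fourier transforms in y of products of L² functions,
which are only L¹. Integrability of `hatW` in y supplies the hypothesis of Fourier inversion, and
Parseval applies. -/
theorem integral_hatW_mul_pairing {φ γ τ u : Space d → ℂ} (hφ2 : MemLp φ 2 volume)
    (hγ2 : MemLp γ 2 volume) (hτ2 : MemLp τ 2 volume) (hu2 : MemLp u 2 volume)
    (k : GL (Fin d) ℝ) (hint : Integrable fun y => hatW φ γ y k) :
    ∫ y, hatW φ γ y k * ∫ ξ, hatRep y k τ ξ * starRingEnd ℂ (u ξ) =
      (adet k : ℂ) * ∫ ξ, (γ ξ * starRingEnd ℂ (u ξ)) *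
        (τ (dual k ξ) * starRingEnd ℂ (φ (dual k ξ))) := by
  have hk : (√(adet k) : ℂ) ≠ 0 := by
    exact_mod_cast (Real.sqrt_pos.2 (adet_pos k)).ne'
  have hsq : ((adet k : ℝ) : ℂ) = (√(adet k) : ℂ) * (√(adet k) : ℂ) := by
    rw [← Complex.ofReal_mul, Real.mul_self_sqrt (adet_pos k).le]
  have ha : Integrable fun ξ => γ ξ * starRingEnd ℂ (φ (dual k ξ)) :=
    hγ2.integrable_mul (memLp_conj (memLp_comp_dual k hφ2))
  have hb : Integrable fun ξ => τ (dual k ξ) * starRingEnd ℂ (u ξ) :=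
    (memLp_comp_dual k hτ2).integrable_mul (memLp_conj hu2)
  have ha' : Integrable (𝓕⁻ fun ξ => γ ξ * starRingEnd ℂ (φ (dual k ξ))) := by
    simp only [hatW_eq_fourierInv] at hint
    refine (hint.const_mul (√(adet k) : ℂ)⁻¹).congr (.of_forall fun y => ?_)
    simp only [inv_mul_cancel_left₀ hk]
  have h1 := integral_fourierInv_mul_fourier ha ha' hb
  simp only [hatW_eq_fourierInv, integral_hatRep_mul_conj_eq_fourier]
  calc _ = ∫ y, (adet k : ℂ) * (𝓕⁻ (fun ξ => γ ξ * starRingEnd ℂ (φ (dual k ξ))) y *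
        𝓕 (fun ξ => τ (dual k ξ) * starRingEnd ℂ (u ξ)) y) := by
          refine integral_congr_ae (.of_forall fun y => ?_)
          simp only [hsq]
          ring
    _ = _ := by
      rw [integral_const_mul, h1]
      congr 2
      funext ξ
      ring

variable [MeasurableSpace H] [BorelSpace H] (μ : Measure H)

theorem integral_haarG [SFinite μ] {F : Space d × H → ℂ} (hF : Integrable F (haarG H μ)) :
    ∫ p, F p ∂(haarG H μ) =
      ∫ k : H, ((adet (k : GL (Fin d) ℝ))⁻¹ : ℂ) * (∫ x, F (x, k)) ∂μ := by
  rw [haarG, integral_prod_symm _ hF, integral_withDensity_eq_integral_toReal_smul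
    measurable_density (.of_forall fun _ => ENNReal.ofReal_lt_top)]
  refine integral_congr_ae (.of_forall fun k => ?_)
  simp only
  rw [ENNReal.toReal_ofReal (by positivity), Complex.real_smul, ← adet_def, Complex.ofReal_inv]

/-- After Parseval in y, the factor |det k| cancels the Haar density and the k-integral is an orbit
average, constant in ξ. Since T is a test function this average converges absolutely, so no further
admissibility condition on φ enters. -/
theorem integral_hatW_mul_test [μ.IsHaarMeasure] (hH : IsAdmissible H ξ₀)
    {φ γ u : Space d → ℂ} (hφ : Measurable φ) (hφ2 : MemLp φ 2 volume)
    (hγ2 : MemLp γ 2 volume) (hu2 : MemLp u 2 volume) (T : 𝓓(hH.orbit, ℂ))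
    (hT : ∀ ξ, starRingEnd ℂ (T ξ) = T ξ)
    (hγint : ∀ᵐ k : H ∂μ, Integrable fun y => hatW φ γ y k)
    (hint : Integrable (fun p : Space d × H => hatW φ γ p.1 p.2 *
      ∫ ξ, hatRep p.1 p.2 T ξ * starRingEnd ℂ (u ξ)) (haarG H μ)) :
    ∫ p, hatW φ γ p.1 p.2 * (∫ ξ, hatRep p.1 p.2 T ξ * starRingEnd ℂ (u ξ)) ∂(haarG H μ) =
      starRingEnd ℂ (∫ k : H, T (dual (k : GL (Fin d) ℝ) ξ₀) *
        φ (dual (k : GL (Fin d) ℝ) ξ₀) ∂μ) * ∫ ξ, γ ξ * starRingEnd ℂ (u ξ) := by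
  have : LocallyCompactSpace H := locallyCompactSpace_of_isClosed hH.isClosed
  have hT2 : MemLp T 2 volume := (testSchwartz T).memLp 2 volume
  have hγu : Integrable fun ξ => γ ξ * starRingEnd ℂ (u ξ) :=
    hγ2.integrable_mul (memLp_conj hu2)
  have hTφ : ∀ ξ ∈ dualOrbit H ξ₀, Integrable (fun k : H => T (dual (k : GL (Fin d) ℝ) ξ) *
      starRingEnd ℂ (φ (dual (k : GL (Fin d) ℝ) ξ))) μ := by
    intro ξ hξ
    have h := integrable_test_mul_dual μ hH hφ hφ2 T hξ
    refine (h.norm.mono' (Complex.continuous_conj.comp_aestronglyMeasurable h.1)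
      (.of_forall fun k => by simp)).congr (.of_forall fun k => ?_)
    simp [hT]
  rw [integral_haarG μ hint]
  have h1 : ∀ᵐ k : H ∂μ, ((adet (k : GL (Fin d) ℝ))⁻¹ : ℂ) *
      (∫ y, hatW φ γ y k * ∫ ξ, hatRep y k T ξ * starRingEnd ℂ (u ξ)) =
      ∫ ξ, (γ ξ * starRingEnd ℂ (u ξ)) * (T (dual (k : GL (Fin d) ℝ) ξ) *
        starRingEnd ℂ (φ (dual (k : GL (Fin d) ℝ) ξ))) := by
    filter_upwards [hγint] with k hk
    rw [integral_hatW_mul_pairing hφ2 hγ2 hT2 hu2 k hk, inv_mul_cancel_left₀]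
    exact_mod_cast (adet_pos (k : GL (Fin d) ℝ)).ne'
  rw [integral_congr_ae h1]
  have hm1 : Measurable fun z : H × Space d => T (dual (z.1 : GL (Fin d) ℝ) z.2) *
      starRingEnd ℂ (φ (dual (z.1 : GL (Fin d) ℝ) z.2)) :=
    (measurable_comp_dual T.continuous.measurable).mul
      (Complex.continuous_conj.measurable.comp (measurable_comp_dual hφ))
  have hprod : Integrable (fun z : H × Space d => (γ z.2 * starRingEnd ℂ (u z.2)) *
      (T (dual (z.1 : GL (Fin d) ℝ) z.2) * starRingEnd ℂ (φ (dual (z.1 : GL (Fin d) ℝ) z.2))))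
      (μ.prod volume) := by
    have hm : AEStronglyMeasurable (fun z : H × Space d => (γ z.2 * starRingEnd ℂ (u z.2)) *
        (T (dual (z.1 : GL (Fin d) ℝ) z.2) *
          starRingEnd ℂ (φ (dual (z.1 : GL (Fin d) ℝ) z.2)))) (μ.prod volume) :=
      hγu.1.comp_snd.mul hm1.aestronglyMeasurable
    refine (integrable_prod_iff' hm).2 ?_
    constructor
    · filter_upwards [ae_mem_dualOrbit hH] with ξ hξ
      exact (hTφ ξ hξ).const_mul _
    · refine (hγu.norm.mul_const (∫ k : H, ‖T (dual (k : GL (Fin d) ℝ) ξ₀) *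
        starRingEnd ℂ (φ (dual (k : GL (Fin d) ℝ) ξ₀))‖ ∂μ)).congr ?_
      filter_upwards [ae_mem_dualOrbit hH] with ξ hξ
      simp_rw [norm_mul (γ ξ * starRingEnd ℂ (u ξ))]
      rw [integral_const_mul, integral_dual_eq_of_mem_dualOrbit μ
        (F := fun η => ‖T η * starRingEnd ℂ (φ η)‖) hξ]
  have h2 := integral_integral_swap (f := fun (k : H) (ξ : Space d) =>
    (γ ξ * starRingEnd ℂ (u ξ)) * (T (dual (k : GL (Fin d) ℝ) ξ) *
      starRingEnd ℂ (φ (dual (k : GL (Fin d) ℝ) ξ)))) hprod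
  rw [h2, ← integral_const_mul]
  refine integral_congr_ae ?_
  filter_upwards [ae_mem_dualOrbit hH] with ξ hξ
  rw [integral_const_mul, integral_dual_eq_of_mem_dualOrbit μ
    (F := fun η => T η * starRingEnd ℂ (φ η)) hξ, ← integral_conj, mul_comm]
  simp only [map_mul, hT]

end

/-! ### Truncated reproducing integrals are test functions. -/

section

theorem contDiff_integral_of_contDiff {V W : Type*} [NormedAddCommGroup V] [NormedSpace ℝ V]
    [NormedAddCommGroup W] [NormedSpace ℝ W] [FiniteDimensional ℝ W] [MeasurableSpace W]
    [BorelSpace W] {ν : Measure W} [IsFiniteMeasure ν] {R : ℝ}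
    (hν : ∀ᵐ x ∂ν, ‖x‖ ≤ R) {n : ℕ∞} {Φ : V × W → ℂ} (hΦ : ContDiff ℝ n Φ) :
    ContDiff ℝ n fun v => ∫ x, Φ (v, x) ∂ν := by
  let χ : ContDiffBump (0 : W) := ⟨max R 1, max R 1 + 1, by positivity, by linarith⟩
  -- The integral is the convolution of the constant 1 with x ↦ χ(x) Φ(v, -x), evaluated at 0. The
  -- cutoff χ is 1 on the ball carrying ν, so it does not change the value.
  have h1 := contDiffOn_convolution_right_with_param (𝕜 := ℝ) (μ := ν) (f := fun _ : W => (1 : ℝ))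
    (n := n) (ContinuousLinearMap.lsmul ℝ ℝ) (g := fun (v : V) (x : W) => (χ x : ℝ) • Φ (v, -x))
    (s := Set.univ) (k := tsupport χ) isOpen_univ χ.hasCompactSupport
    (fun v x _ hx => by simp [image_eq_zero_of_notMem_tsupport hx])
    (locallyIntegrable_const _) (by
      refine ContDiff.contDiffOn ?_
      have h2 : ContDiff ℝ n fun z : V × W => Φ (z.1, -z.2) :=
        hΦ.comp (contDiff_fst.prodMk contDiff_snd.neg)
      exact (χ.contDiff.comp contDiff_snd).smul h2)
  rw [Set.univ_prod_univ, contDiffOn_univ] at h1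
  have h3 := h1.comp (contDiff_id.prodMk (contDiff_const (c := (0 : W))))
  convert h3 using 1
  funext v
  simp only [Function.comp_def, convolution, id]
  symm
  refine integral_congr_ae ?_
  filter_upwards [hν] with x hx
  have h4 : χ (-x) = 1 := χ.one_of_mem_closedBall
    (mem_closedBall_zero_iff.2 ((norm_neg x).trans_le (hx.trans (le_max_left R 1))))
  simp [h4]

variable {d : ℕ} {H : Subgroup (GL (Fin d) ℝ)} {ξ₀ : Space d}

variable [MeasurableSpace H] [BorelSpace H]

omit [MeasurableSpace H] [BorelSpace H] in
theorem exists_norm_le_of_isCompact {E : Set (Space d × H)} (hE : IsCompact E) :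
    ∃ R : ℝ, ∀ p ∈ E, ‖p.1‖ ≤ R ∧ ‖dual (p.2 : GL (Fin d) ℝ)‖ ≤ R ∧
      √(adet (p.2 : GL (Fin d) ℝ)) ≤ R := by
  have h1 : Continuous fun p : Space d × H => dual (p.2 : GL (Fin d) ℝ) :=
    continuous_dual.comp (continuous_subtype_val.comp continuous_snd)
  have h2 : Continuous fun p : Space d × H => √(adet (p.2 : GL (Fin d) ℝ)) :=
    (continuous_adet_coe.comp continuous_snd).sqrt
  obtain ⟨R, hR⟩ := hE.bddAbove_image
    (f := fun p => ‖p.1‖ + ‖dual (p.2 : GL (Fin d) ℝ)‖ + √(adet (p.2 : GL (Fin d) ℝ)))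
    ((continuous_fst.norm.add h1.norm).add h2).continuousOn
  refine ⟨R, fun p hp => ?_⟩
  have h3 := hR ⟨p, hp, rfl⟩
  have h4 := norm_nonneg p.1
  have h5 := norm_nonneg (dual (p.2 : GL (Fin d) ℝ))
  have h6 := Real.sqrt_nonneg (adet (p.2 : GL (Fin d) ℝ))
  simp only at h3
  exact ⟨by linarith, by linarith, by linarith⟩

/-- The finite measure |s| m on E is pushed forward to a finite-dimensional vector space of
translations, linear maps and scalars. The integrand becomes jointly smooth there; the merely
measurable phase s/|s| is part of the scalar coordinate, and compactness of E bounds the support. -/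
theorem contDiff_integral_mul_hatRep {m : Measure (Space d × H)} {E : Set (Space d × H)}
    (hE : IsCompact E) {s : Space d × H → ℂ} (hs : Measurable s) (hsE : IntegrableOn s E m)
    {n : ℕ∞} {T : Space d → ℂ} (hT : ContDiff ℝ n T) :
    ContDiff ℝ n fun ξ => ∫ p in E, s p * hatRep p.1 p.2 T ξ ∂m := by
  obtain ⟨R, hR⟩ := exists_norm_le_of_isCompact hE
  let W := Space d × (Space d →L[ℝ] Space d) × ℂ
  have : SecondCountableTopology (Space d →L[ℝ] Space d) := by
    have := FiniteDimensional.proper ℝ (Space d →L[ℝ] Space d)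
    infer_instance
  let Q : Space d × H → W := fun p => (p.1, dual (p.2 : GL (Fin d) ℝ),
    (√(adet (p.2 : GL (Fin d) ℝ)) : ℂ) * ((‖s p‖⁻¹ : ℝ) * s p))
  have hQ : Measurable Q := by
    have h1 : Continuous fun p : Space d × H => dual (p.2 : GL (Fin d) ℝ) :=
      continuous_dual.comp (continuous_subtype_val.comp continuous_snd)
    have h2 : Continuous fun p : Space d × H => (√(adet (p.2 : GL (Fin d) ℝ)) : ℂ) :=
      Complex.continuous_ofReal.comp (continuous_adet_coe.comp continuous_snd).sqrt
    exact measurable_fst.prodMk (h1.measurable.prodMk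
      (h2.measurable.mul ((Complex.measurable_ofReal.comp hs.norm.inv).mul hs)))
  have hsm : Measurable fun p => ‖s p‖ₑ := hs.enorm
  let ρ : Measure (Space d × H) := (m.restrict E).withDensity fun p => ‖s p‖ₑ
  have : IsFiniteMeasure ρ := isFiniteMeasure_withDensity hsE.2.ne
  have hEm : MeasurableSet E := hE.measurableSet
  have hρ : ∀ᵐ x ∂(ρ.map Q), ‖x‖ ≤ R := by
    rw [ae_map_iff hQ.aemeasurable (measurableSet_le measurable_norm measurable_const)]
    refine (withDensity_absolutelyContinuous _ _).ae_le ?_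
    refine (ae_restrict_iff' hEm).2 (.of_forall fun p hp => ?_)
    obtain ⟨h1, h2, h3⟩ := hR p hp
    refine norm_prod_le_iff.2 ⟨h1, norm_prod_le_iff.2 ⟨h2, ?_⟩⟩
    have h4 : ‖((‖s p‖⁻¹ : ℝ) * s p : ℂ)‖ ≤ 1 := by
      rw [norm_mul, Complex.norm_real, norm_inv, norm_norm]
      exact inv_mul_le_one
    calc ‖(√(adet (p.2 : GL (Fin d) ℝ)) : ℂ) * ((‖s p‖⁻¹ : ℝ) * s p)‖
        = √(adet (p.2 : GL (Fin d) ℝ)) * ‖((‖s p‖⁻¹ : ℝ) * s p : ℂ)‖ := by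
          rw [norm_mul, Complex.norm_real, Real.norm_of_nonneg (Real.sqrt_nonneg _)]
      _ ≤ √(adet (p.2 : GL (Fin d) ℝ)) * 1 := by gcongr
      _ ≤ R := by rwa [mul_one]
  let Φ : Space d × W → ℂ := fun z => z.2.2.2 * chr (-inner ℝ z.2.1 z.1) * T (z.2.2.1 z.1)
  have hΦ : ContDiff ℝ n Φ := by
    have h1 : ContDiff ℝ n fun z : Space d × W => z.2.2.2 := contDiff_snd.snd.snd
    have h2 : ContDiff ℝ n fun z : Space d × W => -inner ℝ z.2.1 z.1 :=
      (ContDiff.inner ℝ contDiff_snd.fst contDiff_fst).neg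
    have h3 : ContDiff ℝ n fun z : Space d × W => z.2.2.1 z.1 :=
      contDiff_snd.snd.fst.clm_apply contDiff_fst
    exact (h1.mul ((contDiff_chr.of_le le_top).comp h2)).mul (hT.comp h3)
  convert contDiff_integral_of_contDiff hρ hΦ using 1
  funext ξ
  symm
  have hΦξ : Continuous fun x => Φ (ξ, x) := hΦ.continuous.comp (by fun_prop)
  rw [integral_map hQ.aemeasurable hΦξ.measurable.aestronglyMeasurable,
    integral_withDensity_eq_integral_toReal_smul hsm (.of_forall fun _ => enorm_lt_top)]
  refine integral_congr_ae (.of_forall fun p => ?_)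
  by_cases hp : s p = 0
  · simp [hp]
  · have h5 : (‖s p‖ : ℂ) ≠ 0 := by simpa using hp
    simp only [Φ, Q, hatRep, toReal_enorm, Complex.real_smul, Complex.ofReal_inv]
    field_simp

/-- The truncated reproducing integral of a test function is a test function. -/
theorem exists_test_eq_integral (hH : IsAdmissible H ξ₀) {m : Measure (Space d × H)}
    {E : Set (Space d × H)} (hE : IsCompact E) {s : Space d × H → ℂ} (hs : Measurable s)
    (hsE : IntegrableOn s E m) (T : 𝓓(hH.orbit, ℂ)) :
    ∃ g : 𝓓(hH.orbit, ℂ), ∀ ξ, g ξ = ∫ p in E, s p * hatRep p.1 p.2 T ξ ∂m := by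
  let K : Set (Space d) := (fun z : (Space d × H) × Space d =>
    dual ((z.1.2⁻¹ : H) : GL (Fin d) ℝ) z.2) '' (E ×ˢ tsupport T)
  have hK : IsCompact K := by
    refine (hE.prod T.hasCompactSupport).image ?_
    have h := continuous_dual_apply.comp
      ((continuous_fst.snd.inv : Continuous fun z : (Space d × H) × Space d => z.1.2⁻¹).prodMk
        continuous_snd)
    exact h
  have hKO : K ⊆ dualOrbit H ξ₀ := by
    rintro _ ⟨z, hz, rfl⟩
    exact dual_mem_dualOrbit _ (T.tsupport_subset hz.2)
  have hsupp : Function.support (fun ξ => ∫ p in E, s p * hatRep p.1 p.2 T ξ ∂m) ⊆ K := by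
    intro ξ hξ
    by_contra hK'
    refine hξ (setIntegral_eq_zero_of_forall_eq_zero fun p hp => ?_)
    have h1 : T (dual (p.2 : GL (Fin d) ℝ) ξ) = 0 := by
      by_contra hne
      refine hK' ⟨(p, dual (p.2 : GL (Fin d) ℝ) ξ), ⟨hp, subset_tsupport _ hne⟩, ?_⟩
      simp only [Subgroup.coe_inv, dual_inv_dual]
    simp [hatRep, h1]
  have hts := closure_minimal hsupp hK.isClosed
  exact ⟨⟨_, contDiff_integral_mul_hatRep hE hs hsE T.contDiff,
    hK.of_isClosed_subset (isClosed_tsupport _) hts, hts.trans hKO⟩, fun ξ => rfl⟩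

end

/-! ### Density of test functions in the weighted norm. -/

section

variable {d : ℕ} {H : Subgroup (GL (Fin d) ℝ)} {ξ₀ : Space d}

variable [MeasurableSpace H] [BorelSpace H] (μ : Measure H)

theorem exists_isCompact_lintegral_compl_lt {X : Type*} [TopologicalSpace X]
    [WeaklyLocallyCompactSpace X] [SigmaCompactSpace X] [T2Space X] [MeasurableSpace X]
    [BorelSpace X] {m : Measure X} {F : X → ℝ≥0∞} (hF : ∫⁻ x, F x ∂m ≠ ∞) {ε : ℝ≥0∞}
    (hε : ε ≠ 0) : ∃ E : Set X, IsCompact E ∧ ∫⁻ x in Eᶜ, F x ∂m < ε := by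
  let K : CompactExhaustion X := CompactExhaustion.choice X
  have hm : ∀ n, MeasurableSet (K n)ᶜ := fun n => (K.isCompact n).measurableSet.compl
  have h1 : Filter.Tendsto (m.withDensity F ∘ fun n => (K n)ᶜ) Filter.atTop
      (𝓝 (m.withDensity F (⋂ n, (K n)ᶜ))) := by
    refine tendsto_measure_iInter_atTop (fun n => (hm n).nullMeasurableSet)
      (fun i j hij => Set.compl_subset_compl.2 (K.subset hij)) ⟨0, ?_⟩
    refine ne_top_of_le_ne_top hF ?_
    rw [withDensity_apply _ (hm 0)]
    exact setLIntegral_le_lintegral _ _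
  rw [← Set.compl_iUnion, K.iUnion_eq, Set.compl_univ, measure_empty] at h1
  obtain ⟨n, hn⟩ := (h1.eventually_lt_const hε.bot_lt).exists
  exact ⟨K n, K.isCompact n, by rwa [Function.comp_apply, withDensity_apply _ (hm n)] at hn⟩

-- Weights are bounded below on compact sets, since w(1) ≤ w(h⁻¹) w(h) and w is bounded above on the
-- inverses.
omit [BorelSpace H] in
theorem IsWeight.exists_one_le_mul {w : H → ℝ} (hw : IsWeight H w) {E : Set (Space d × H)}
    (hE : IsCompact E) : ∃ D : ℝ, ∀ p ∈ E, 1 ≤ D * w p.2 := by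
  obtain ⟨D, hD⟩ := hw.exists_le_of_isCompact (hE.image (continuous_snd.inv :
    Continuous fun p : Space d × H => p.2⁻¹))
  refine ⟨(w 1)⁻¹ * D, fun p hp => ?_⟩
  have h1 := hw.submultiplicative p.2⁻¹ p.2
  rw [inv_mul_cancel] at h1
  have h2 : w 1 ≤ D * w p.2 :=
    h1.trans (mul_le_mul_of_nonneg_right (hD _ ⟨p, hp, rfl⟩) (hw.pos _).le)
  rwa [mul_assoc, ← div_eq_inv_mul, one_le_div (hw.pos 1)]

theorem integrableOn_hatW {w : H → ℝ} (hw : IsWeight H w) {φ γ : Space d → ℂ}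
    (hφ : Measurable φ) (hγ : Measurable γ) (hW : weightedNorm μ w φ γ ≠ ∞)
    {E : Set (Space d × H)} (hE : IsCompact E) :
    IntegrableOn (fun p => hatW φ γ p.1 p.2) E (haarG H μ) := by
  obtain ⟨D, hD⟩ := hw.exists_one_le_mul hE
  refine ⟨(measurable_hatW hφ hγ).aestronglyMeasurable, ?_⟩
  have hle : ∫⁻ p in E, ‖hatW φ γ p.1 p.2‖ₑ ∂(haarG H μ) ≤
      ∫⁻ p in E, ENNReal.ofReal D * (ENNReal.ofReal (w p.2) * ‖hatW φ γ p.1 p.2‖ₑ)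
        ∂(haarG H μ) := by
    refine setLIntegral_mono' hE.measurableSet fun p hp => ?_
    rw [← mul_assoc, ← ENNReal.ofReal_mul' (hw.pos _).le]
    exact le_mul_of_one_le_left' (ENNReal.one_le_ofReal.2 (hD p hp))
  refine hle.trans_lt ?_
  rw [lintegral_const_mul' _ _ ENNReal.ofReal_ne_top]
  exact ENNReal.mul_lt_top ENNReal.ofReal_lt_top
    ((setLIntegral_le_lintegral _ _).trans_lt hW.lt_top)

theorem ae_integrable_hatW [SFinite μ] {w : H → ℝ} (hw : IsWeight H w) {φ γ : Space d → ℂ}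
    (hφ : Measurable φ) (hγ : Measurable γ) (hW : weightedNorm μ w φ γ ≠ ∞) :
    ∀ᵐ k : H ∂μ, Integrable fun y => hatW φ γ y k := by
  have hm : Measurable fun p : Space d × H =>
      ENNReal.ofReal (w p.2) * ‖hatW φ γ p.1 p.2‖ₑ :=
    (hw.measurable.comp measurable_snd).ennreal_ofReal.mul (measurable_hatW hφ hγ).enorm
  rw [weightedNorm, lintegral_haarG μ hm] at hW
  have hm2 : Measurable fun k : H => ENNReal.ofReal (adet (k : GL (Fin d) ℝ))⁻¹ *
      ∫⁻ x, ENNReal.ofReal (w k) * ‖hatW φ γ x k‖ₑ :=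
    continuous_adet_coe.measurable.inv.ennreal_ofReal.mul hm.lintegral_prod_left'
  filter_upwards [ae_lt_top hm2 hW] with k hk
  refine ⟨((measurable_hatW hφ hγ).comp measurable_prodMk_right).aestronglyMeasurable, ?_⟩
  rw [lintegral_const_mul' _ _ ENNReal.ofReal_ne_top] at hk
  have h1 : ENNReal.ofReal (adet (k : GL (Fin d) ℝ))⁻¹ ≠ 0 := by
    simpa using adet_pos (k : GL (Fin d) ℝ)
  have h2 : ENNReal.ofReal (w k) ≠ 0 := by simpa using hw.pos k
  refine lt_top_iff_ne_top.2 fun h => ?_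
  change ∫⁻ x, ‖hatW φ γ x k‖ₑ = ∞ at h
  rw [h, ENNReal.mul_top h2, ENNReal.mul_top h1] at hk
  exact hk.ne rfl

omit [MeasurableSpace H] [BorelSpace H] in
theorem hatW_sub {φ γ g : Space d → ℂ} (hφ2 : MemLp φ 2 volume) (hγ2 : MemLp γ 2 volume)
    (hg2 : MemLp g 2 volume) (x : Space d) (k : GL (Fin d) ℝ) :
    hatW φ (fun ξ => γ ξ - g ξ) x k = hatW φ γ x k - hatW φ g x k := by
  have h1 := memLp_conj (memLp_hatRep x k hφ2)
  have hi : Integrable fun ξ => γ ξ * starRingEnd ℂ (hatRep x k φ ξ) := hγ2.integrable_mul h1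
  have hj : Integrable fun ξ => g ξ * starRingEnd ℂ (hatRep x k φ ξ) := hg2.integrable_mul h1
  simp only [hatW, sub_mul]
  exact integral_sub hi hj

/-- Since g is the part over E of the reproducing integral of γ, the transform of γ − g is the part
over the complement, to which the weighted Young inequality applies. -/
theorem weightedNorm_sub_truncation_le [μ.IsHaarMeasure] (hH : IsAdmissible H ξ₀) {w : H → ℝ}
    (hw : IsWeight H w) {φ γ : Space d → ℂ} (hφ : Measurable φ) (hφ2 : MemLp φ 2 volume)
    (hγ : Measurable γ) (hγ2 : MemLp γ 2 volume) (hW : weightedNorm μ w φ γ ≠ ∞)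
    {T g : 𝓓(hH.orbit, ℂ)} (hT : ∀ ξ, starRingEnd ℂ (T ξ) = T ξ) {c : ℂ}
    (hc : ∫ k : H, T (dual (k : GL (Fin d) ℝ) ξ₀) * φ (dual (k : GL (Fin d) ℝ) ξ₀) ∂μ =
      starRingEnd ℂ c) (hc0 : c ≠ 0) {E : Set (Space d × H)} (hE : IsCompact E)
    (hg : ∀ ξ, g ξ = ∫ p in E, (c⁻¹ * hatW φ γ p.1 p.2) * hatRep p.1 p.2 T ξ ∂(haarG H μ)) :
    weightedNorm μ w φ (fun ξ => γ ξ - g ξ) ≤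
      (‖c⁻¹‖ₑ * ∫⁻ p in Eᶜ, ENNReal.ofReal (w p.2) * ‖hatW φ γ p.1 p.2‖ₑ ∂(haarG H μ)) *
        weightedNorm μ w φ T := by
  have : LocallyCompactSpace H := locallyCompactSpace_of_isClosed hH.isClosed
  have hT2 : MemLp T 2 volume := (testSchwartz T).memLp 2 volume
  have hg2 : MemLp g 2 volume := (testSchwartz g).memLp 2 volume
  have hTm : Measurable T := T.continuous.measurable
  have hs : Measurable fun p : Space d × H => c⁻¹ * hatW φ γ p.1 p.2 :=
    (measurable_hatW hφ hγ).const_mul _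
  have h1 := weightedNorm_le_of_integral_rep μ hw (ν := (haarG H μ).restrict Eᶜ) hs measurable_id
    hφ hTm (γ := fun ξ => γ ξ - g ξ) ?_
  · refine h1.trans_eq ?_
    rw [← lintegral_const_mul' _ _ enorm_ne_top]
    congr 1
    refine lintegral_congr fun p => ?_
    rw [enorm_mul, id]
    ring
  intro q hq
  obtain ⟨h2, h3⟩ := hatW_eq_integral_of_ae_eq
    ((integrableOn_hatW μ hw hφ hγ hW hE).const_mul c⁻¹) measurable_id hφ2 hTm hT2 (γ := g)
    (.of_forall hg) q
  simp only [id] at h2 h3 hq ⊢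
  -- Integrability over E is automatic; over the complement it is the premise `hq` of the
  -- conditional representation.
  have h4 : Integrable (fun p : Space d × H => c⁻¹ * hatW φ γ p.1 p.2 *
      hatW φ T (invMul p q).1 (invMul p q).2) (haarG H μ) := by
    rw [← integrableOn_univ, ← Set.union_compl_self E]
    exact IntegrableOn.union h2 hq
  have h5 := integral_add_compl hE.measurableSet h4
  rw [← h3] at h5
  have h6 : ∫ p : Space d × H, c⁻¹ * hatW φ γ p.1 p.2 *
      hatW φ T (invMul p q).1 (invMul p q).2 ∂(haarG H μ) = hatW φ γ q.1 q.2 := by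
    have h7 : Integrable (fun p : Space d × H => hatW φ γ p.1 p.2 *
        hatW φ T (invMul p q).1 (invMul p q).2) (haarG H μ) := by
      refine (h4.const_mul c).congr (.of_forall fun p => ?_)
      simp only
      field_simp
    simp only [hatW_invMul] at h7 ⊢
    simp only [mul_assoc, integral_const_mul]
    rw [integral_hatW_mul_test μ hH hφ hφ2 hγ2 (memLp_hatRep q.1 q.2 hφ2) T hT
      (ae_integrable_hatW μ hw hφ hγ hW) h7, hc, Complex.conj_conj, inv_mul_cancel_left₀ hc0, hatW]
  rw [hatW_sub hφ2 hγ2 hg2, ← h6, ← h5]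
  ring

theorem exists_test_weightedNorm_sub_le [μ.IsHaarMeasure] (hH : IsAdmissible H ξ₀) {w : H → ℝ}
    (hw : IsWeight H w) {φ γ : Space d → ℂ} (hφ : Measurable φ) (hφ2 : MemLp φ 2 volume)
    (hφ0 : ¬ φ =ᵐ[volume] 0) (hφφ : weightedNorm μ w φ φ ≠ ∞) (hγ : Measurable γ)
    (hγ2 : MemLp γ 2 volume) (hW : weightedNorm μ w φ γ ≠ ∞) {ε : ℝ≥0∞} (hε : ε ≠ 0) :
    ∃ g : 𝓓(hH.orbit, ℂ), weightedNorm μ w φ (fun ξ => γ ξ - g ξ) ≤ ε := by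
  have : LocallyCompactSpace H := locallyCompactSpace_of_isClosed hH.isClosed
  obtain ⟨T, hT, hTφ⟩ := exists_test_integral_ne_zero μ hH hφ hφ2 hφ0
  obtain ⟨c, hc⟩ : ∃ c : ℂ, ∫ k : H, T (dual (k : GL (Fin d) ℝ) ξ₀) *
      φ (dual (k : GL (Fin d) ℝ) ξ₀) ∂μ = starRingEnd ℂ c := ⟨_, (Complex.conj_conj _).symm⟩
  have hc0 : c ≠ 0 := by
    rintro rfl
    exact hTφ (hc.trans (map_zero _))
  -- The error bound carries the norm of T itself, which is finite by the estimate already proved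
  -- for test functions.
  obtain ⟨M, hM, hMT⟩ := exists_weightedNorm_test_le μ hH hw hφ hφ2 hφ0 T.hasCompactSupport
    T.tsupport_subset
  have hTtop : weightedNorm μ w φ T ≠ ∞ :=
    ne_top_of_le_ne_top (ENNReal.mul_ne_top (ENNReal.mul_ne_top hM
      (SchwartzMap.integrable _).2.ne) hφφ) (hMT T (subset_tsupport _))
  have hCtop : ‖c⁻¹‖ₑ * weightedNorm μ w φ T ≠ ∞ := ENNReal.mul_ne_top enorm_ne_top hTtop
  obtain ⟨E, hE, hEε⟩ := exists_isCompact_lintegral_compl_lt hW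
    (ENNReal.div_ne_zero.2 ⟨hε, hCtop⟩)
  obtain ⟨g, hg⟩ := exists_test_eq_integral hH hE ((measurable_hatW hφ hγ).const_mul c⁻¹)
    ((integrableOn_hatW μ hw hφ hγ hW hE).const_mul c⁻¹) T
  refine ⟨g, (weightedNorm_sub_truncation_le μ hH hw hφ hφ2 hγ hγ2 hW hT hc hc0 hE hg).trans ?_⟩
  rw [mul_right_comm]
  exact (mul_le_mul_right hEε.le _).trans ENNReal.mul_div_le

end

/-! ### Back to H¹_w, its reservoir and distributions. -/

section

variable {d : ℕ} {H : Subgroup (GL (Fin d) ℝ)} {ξ₀ : Space d}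

theorem fourier_fourierInvTest_ae_eq {U : TopologicalSpace.Opens (Space d)} (g : 𝓓(U, ℂ)) :
    (𝓕 (fourierInvTest g) : L2 d) =ᵐ[volume] g := by
  have h : (𝓕 (fourierInvTest g) : L2 d) = (testSchwartz g).toLp 2 := by
    change 𝓕 ((𝓕⁻ (testSchwartz g)).toLp 2) = _
    rw [SchwartzMap.toLp_fourier_eq, FourierTransform.fourier_fourierInv_eq]
  rw [h]
  exact SchwartzMap.coeFn_toLp _ _ _

theorem fourierInvTest_add {U : TopologicalSpace.Opens (Space d)} (g g' : 𝓓(U, ℂ)) :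
    fourierInvTest (g + g') = fourierInvTest g + fourierInvTest g' := by
  have h : testSchwartz (g + g') = testSchwartz g + testSchwartz g' := rfl
  change (𝓕⁻ (testSchwartz (g + g'))).toLp 2 = _
  rw [h, FourierTransform.fourierInv_add]
  rfl

theorem fourierInvTest_smul {U : TopologicalSpace.Opens (Space d)} (c : ℂ) (g : 𝓓(U, ℂ)) :
    fourierInvTest (c • g) = c • fourierInvTest g := by
  have h : testSchwartz (c • g) = c • testSchwartz g := rfl
  change (𝓕⁻ (testSchwartz (c • g))).toLp 2 = _
  rw [h, FourierTransform.fourierInv_smul]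
  rfl

theorem conjTest_add {U : TopologicalSpace.Opens (Space d)} (g g' : 𝓓(U, ℂ)) :
    conjTest (g + g') = conjTest g + conjTest g' := map_add _ g g'

theorem conjTest_smul {U : TopologicalSpace.Opens (Space d)} (c : ℂ) (g : 𝓓(U, ℂ)) :
    conjTest (c • g) = starRingEnd ℂ c • conjTest g := by
  refine TestFunction.ext fun x => ?_
  change conjTest (c • g) x = starRingEnd ℂ c * conjTest g x
  rw [conjTest_apply, conjTest_apply, ← map_mul]
  rfl

theorem conjTest_conjTest {U : TopologicalSpace.Opens (Space d)} (g : 𝓓(U, ℂ)) :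
    conjTest (conjTest g) = g :=
  TestFunction.ext fun x => by rw [conjTest_apply, conjTest_apply, Complex.conj_conj]

theorem continuous_conjTest {U : TopologicalSpace.Opens (Space d)} :
    Continuous (conjTest : 𝓓(U, ℂ) → 𝓓(U, ℂ)) :=
  (TestFunction.postcompCLM (Complex.conjCLE : ℂ →L[ℝ] ℂ)).continuous

/-- On K the polynomial factor ‖x‖^i of a Schwartz seminorm is bounded, and off K the derivatives
vanish. -/
theorem continuous_testSchwartz_ofSupportedIn {U : TopologicalSpace.Opens (Space d)}
    {K : TopologicalSpace.Compacts (Space d)} (hK : (K : Set (Space d)) ⊆ U) :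
    Continuous fun g : 𝓓_{K}(Space d, ℂ) => testSchwartz (TestFunction.ofSupportedIn hK g) := by
  let S : 𝓓_{K}(Space d, ℂ) →ₗ[ℝ] SchwartzMap (Space d) ℂ :=
    { toFun := fun g => testSchwartz (TestFunction.ofSupportedIn hK g)
      map_add' := fun _ _ => rfl
      map_smul' := fun _ _ => rfl }
  obtain ⟨C, hC⟩ := K.isCompact.isBounded.exists_norm_le
  change Continuous S
  refine WithSeminorms.continuous_of_isBounded (ContDiffMapSupportedIn.withSeminorms ℝ _ _ _ _)
    (schwartz_withSeminorms ℝ _ _) S (.of_real fun i => ⟨{i.2}, |C| ^ i.1, fun g => ?_⟩)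
  rw [Finset.sup_singleton]
  refine SchwartzMap.seminorm_le_bound ℝ i.1 i.2 _ (by positivity) fun x => ?_
  change ‖x‖ ^ i.1 * ‖iteratedFDeriv ℝ i.2 g x‖ ≤ _
  by_cases hx : x ∈ K
  · exact mul_le_mul (pow_le_pow_left₀ (norm_nonneg _) ((hC x hx).trans (le_abs_self C)) _)
      (ContDiffMapSupportedIn.norm_iteratedFDeriv_apply_le_seminorm_top ℝ) (norm_nonneg _)
      (by positivity)
  · have h0 : iteratedFDeriv ℝ i.2 g x = 0 := g.iteratedFDeriv_zero_on_compl hx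
    rw [h0, norm_zero, mul_zero]
    exact mul_nonneg (by positivity) (apply_nonneg _ _)

theorem fourier_ae_ne_zero {ψ : L2 d} (hψ : ψ ≠ 0) : ¬ (𝓕 ψ : L2 d) =ᵐ[volume] 0 := by
  intro h
  refine hψ ?_
  rw [← norm_eq_zero, ← Lp.norm_fourier_eq, norm_eq_zero]
  exact (Lp.eq_zero_iff_ae_eq_zero).2 h

theorem measurable_L2 (f : L2 d) : Measurable f := (Lp.stronglyMeasurable f).measurable

variable [MeasurableSpace H] [BorelSpace H] (μ : Measure H)

omit [BorelSpace H] in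
theorem lintegral_enorm_weight_mul_wavelet {w : H → ℝ} (hw : IsWeight H w) (ψ f : L2 d) :
    ∫⁻ p, ‖(w p.2 : ℂ) * wavelet H ψ f p‖ₑ ∂(haarG H μ) =
      weightedNorm μ w (𝓕 ψ : L2 d) (𝓕 f : L2 d) := by
  refine lintegral_congr fun p => ?_
  rw [enorm_mul, wavelet_eq_hatW, ← ofReal_norm (w p.2 : ℂ), Complex.norm_real,
    Real.norm_of_nonneg (hw.pos _).le]

theorem measurable_weight_mul_wavelet {w : H → ℝ} (hw : IsWeight H w) (ψ f : L2 d) :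
    Measurable fun p : Space d × H => (w p.2 : ℂ) * wavelet H ψ f p := by
  simp only [wavelet_eq_hatW]
  exact (Complex.measurable_ofReal.comp (hw.measurable.comp measurable_snd)).mul
    (measurable_hatW (measurable_L2 _) (measurable_L2 _))

theorem memL1_iff_weightedNorm_ne_top {w : H → ℝ} (hw : IsWeight H w) (ψ f : L2 d) :
    MemL1 H μ w (wavelet H ψ f) ↔ weightedNorm μ w (𝓕 ψ : L2 d) (𝓕 f : L2 d) ≠ ∞ := by
  rw [← lintegral_enorm_weight_mul_wavelet μ hw, ← lt_top_iff_ne_top]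
  exact ⟨fun h => h.2, fun h => ⟨(measurable_weight_mul_wavelet hw ψ f).aestronglyMeasurable, h⟩⟩

theorem H1.norm_eq {w : H → ℝ} (hw : IsWeight H w) {ψ : L2 d} (f : H1 H μ w ψ) :
    ‖f‖ = (weightedNorm μ w (𝓕 ψ : L2 d) (𝓕 f.val : L2 d)).toReal := by
  rw [H1.norm_def, integral_norm_eq_lintegral_enorm
    (measurable_weight_mul_wavelet hw ψ f.val).aestronglyMeasurable,
    lintegral_enorm_weight_mul_wavelet μ hw]

omit [BorelSpace H] in
theorem weightedNorm_congr_ae (w : H → ℝ) (α : Space d → ℂ) {β β' : Space d → ℂ}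
    (h : β =ᵐ[volume] β') : weightedNorm μ w α β = weightedNorm μ w α β' := by
  rw [weightedNorm, weightedNorm, hatW_congr_ae α h]

theorem exists_weightedNorm_fourierInvTest_le [μ.IsHaarMeasure] (hH : IsAdmissible H ξ₀)
    {w : H → ℝ} (hw : IsWeight H w) {ψ : L2 d} (hψ : ψ ∈ analyzing H μ w) (hψ0 : ψ ≠ 0)
    {K : Set (Space d)} (hK : IsCompact K) (hKO : K ⊆ dualOrbit H ξ₀) :
    ∃ M : ℝ≥0∞, M ≠ ∞ ∧ ∀ g : 𝓓(hH.orbit, ℂ), Function.support g ⊆ K →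
      weightedNorm μ w (𝓕 ψ : L2 d) (𝓕 (fourierInvTest g) : L2 d) ≤
        M * ENNReal.ofReal ‖(𝓕⁻ (testSchwartz g) : SchwartzMap (Space d) ℂ).toLp 1‖ := by
  obtain ⟨M, hM, h⟩ := exists_weightedNorm_test_le μ hH hw (measurable_L2 (𝓕 ψ : L2 d))
    (Lp.memLp _) (fourier_ae_ne_zero hψ0) hK hKO
  refine ⟨M * weightedNorm μ w (𝓕 ψ : L2 d) (𝓕 ψ : L2 d),
    ENNReal.mul_ne_top hM ((memL1_iff_weightedNorm_ne_top μ hw ψ ψ).1 hψ), fun g hg => ?_⟩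
  rw [weightedNorm_congr_ae μ w _ (fourier_fourierInvTest_ae_eq g), SchwartzMap.norm_toLp,
    ENNReal.ofReal_toReal (SchwartzMap.memLp _ 1 volume).2.ne, eLpNorm_one_eq_lintegral_enorm,
    mul_right_comm]
  exact h g hg

theorem fourierInvTest_mem [μ.IsHaarMeasure] (hH : IsAdmissible H ξ₀)
    {w : H → ℝ} (hw : IsWeight H w) {ψ : L2 d} (hψ : ψ ∈ analyzing H μ w) (hψ0 : ψ ≠ 0)
    (g : 𝓓(hH.orbit, ℂ)) : fourierInvTest g ∈ H1Submodule H μ w ψ := by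
  obtain ⟨M, hM, h⟩ := exists_weightedNorm_fourierInvTest_le μ hH hw hψ hψ0 g.hasCompactSupport
    g.tsupport_subset
  exact (memL1_iff_weightedNorm_ne_top μ hw ψ _).2 (ne_top_of_le_ne_top
    (ENNReal.mul_ne_top hM ENNReal.ofReal_ne_top) (h g (subset_tsupport _)))

/-- The inverse Fourier transform, as a linear map from test functions to `H¹_w`. -/
def fourierInvH1 {U : TopologicalSpace.Opens (Space d)} {w : H → ℝ} {ψ : L2 d}
    (hmem : ∀ g : 𝓓(U, ℂ), fourierInvTest g ∈ H1Submodule H μ w ψ) :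
    𝓓(U, ℂ) →ₗ[ℂ] H1 H μ w ψ where
  toFun g := ⟨fourierInvTest g, hmem g⟩
  map_add' g g' := H1.ext (fourierInvTest_add g g')
  map_smul' c g := H1.ext (fourierInvTest_smul c g)

theorem denseRange_fourierInvH1 [μ.IsHaarMeasure] (hH : IsAdmissible H ξ₀) {w : H → ℝ}
    (hw : IsWeight H w) {ψ : L2 d} (hψ : ψ ∈ analyzing H μ w) (hψ0 : ψ ≠ 0)
    (hmem : ∀ g : 𝓓(hH.orbit, ℂ), fourierInvTest g ∈ H1Submodule H μ w ψ) :
    DenseRange (fourierInvH1 μ hmem) := by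
  intro f
  refine Metric.mem_closure_range_iff.2 fun ε hε => ?_
  obtain ⟨g, hg⟩ := exists_test_weightedNorm_sub_le μ hH hw (measurable_L2 (𝓕 ψ : L2 d))
    (Lp.memLp _) (fourier_ae_ne_zero hψ0) ((memL1_iff_weightedNorm_ne_top μ hw ψ ψ).1 hψ)
    (measurable_L2 (𝓕 f.val : L2 d)) (Lp.memLp _)
    ((memL1_iff_weightedNorm_ne_top μ hw ψ f.val).1 f.property)
    (ENNReal.ofReal_pos.2 (half_pos hε)).ne'
  refine ⟨g, ?_⟩
  have h1 : (𝓕 (f - fourierInvH1 μ hmem g).val : L2 d) =ᵐ[volume]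
      fun ξ => (𝓕 f.val : L2 d) ξ - g ξ := by
    have h2 : (𝓕 (f - fourierInvH1 μ hmem g).val : L2 d) =
        𝓕 f.val - 𝓕 (fourierInvTest g) :=
      map_sub (Lp.fourierTransformₗᵢ (Space d) ℂ) f.val (fourierInvTest g)
    rw [h2]
    filter_upwards [Lp.coeFn_sub (𝓕 f.val : L2 d) (𝓕 (fourierInvTest g)),
      fourier_fourierInvTest_ae_eq g] with ξ h3 h4
    rw [h3, Pi.sub_apply, h4]
  rw [dist_eq_norm, H1.norm_eq μ hw, weightedNorm_congr_ae μ w _ h1]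
  exact (ENNReal.toReal_le_of_le_ofReal (half_pos hε).le hg).trans_lt (half_lt_self hε)

theorem continuous_comp_fourierInvH1 [μ.IsHaarMeasure] (hH : IsAdmissible H ξ₀) {w : H → ℝ}
    (hw : IsWeight H w) {ψ : L2 d} (hψ : ψ ∈ analyzing H μ w) (hψ0 : ψ ≠ 0)
    (hmem : ∀ g : 𝓓(hH.orbit, ℂ), fourierInvTest g ∈ H1Submodule H μ w ψ)
    (f : Reservoir H μ w ψ) : Continuous fun g => f (fourierInvH1 μ hmem g) := by
  obtain ⟨C, hC, hf⟩ := SemilinearMapClass.bound_of_continuous f f.continuous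
  -- An antilinear functional is still real-linear, which suffices for testing continuity on the LF
  -- space.
  let B : 𝓓(hH.orbit, ℂ) →ₗ[ℝ] ℂ :=
    { toFun := fun g => f (fourierInvH1 μ hmem g)
      map_add' := fun g g' => by rw [map_add, map_add]
      map_smul' := fun c g => by
        have h1 : c • g = (c : ℂ) • g := TestFunction.ext fun x => rfl
        rw [h1, map_smul, map_smulₛₗ, Complex.conj_ofReal]
        rfl }
  change Continuous B
  -- It remains to treat each 𝓓_K, where |B g| ≤ C M ‖𝓕⁻¹g‖_{L¹}. The right side is continuous in g
  -- through the Schwartz space and vanishes at 0.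
  refine (TestFunction.continuous_iff_continuous_comp B).2 fun K hK => ?_
  obtain ⟨M, hM, h⟩ := exists_weightedNorm_fourierInvTest_le μ hH hw hψ hψ0 K.isCompact hK
  have hle : ∀ g : 𝓓_{K}(Space d, ℂ), ‖B (TestFunction.ofSupportedIn hK g)‖ ≤
      C * (M.toReal * ‖(𝓕⁻ (testSchwartz (TestFunction.ofSupportedIn hK g)) :
        SchwartzMap (Space d) ℂ).toLp 1‖) := by
    intro g
    refine (hf _).trans (mul_le_mul_of_nonneg_left ?_ hC.le)
    have h1 := ENNReal.toReal_mono (ENNReal.mul_ne_top hM ENNReal.ofReal_ne_top)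
      (h (TestFunction.ofSupportedIn hK g) g.support_subset)
    rw [ENNReal.toReal_mul, ENNReal.toReal_ofReal (norm_nonneg _)] at h1
    exact (H1.norm_eq μ hw _).trans_le h1
  have hc : Continuous fun g : 𝓓_{K}(Space d, ℂ) => C * (M.toReal *
      ‖(𝓕⁻ (testSchwartz (TestFunction.ofSupportedIn hK g)) :
        SchwartzMap (Space d) ℂ).toLp 1 volume‖) := by
    have h2 := (SchwartzMap.toLpCLM ℂ ℂ (E := Space d) 1 volume).continuous.comp
      ((ContinuousFourierInv.continuous_fourierInv (E := SchwartzMap (Space d) ℂ)).comp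
        (continuous_testSchwartz_ofSupportedIn hK))
    exact continuous_const.mul (continuous_const.mul h2.norm)
  refine continuous_of_continuousAt_zero
    (B.toAddMonoidHom.comp (TestFunction.ofSupportedInCLM ℝ hK).toLinearMap.toAddMonoidHom) ?_
  have h0 : (𝓕⁻ (testSchwartz (TestFunction.ofSupportedIn hK 0)) :
      SchwartzMap (Space d) ℂ).toLp 1 volume = 0 := by
    have h1 : testSchwartz (TestFunction.ofSupportedIn hK 0) = 0 := rfl
    rw [h1, FourierTransform.fourierInv_zero]
    rfl
  have h3 := hc.tendsto 0
  rw [h0, norm_zero, mul_zero, mul_zero] at h3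
  have h4 : B (TestFunction.ofSupportedIn hK 0) = 0 := map_zero B
  change Filter.Tendsto (fun g => B (TestFunction.ofSupportedIn hK g)) (𝓝 0)
    (𝓝 (B (TestFunction.ofSupportedIn hK 0)))
  rw [h4]
  exact squeeze_zero_norm hle h3

/-- The Fourier transform of an element of the reservoir, as a distribution on the dual orbit. -/
def reservoirFourier [μ.IsHaarMeasure] (hH : IsAdmissible H ξ₀) {w : H → ℝ}
    (hw : IsWeight H w) {ψ : L2 d} (hψ : ψ ∈ analyzing H μ w) (hψ0 : ψ ≠ 0)
    (hmem : ∀ g : 𝓓(hH.orbit, ℂ), fourierInvTest g ∈ H1Submodule H μ w ψ)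
    (f : Reservoir H μ w ψ) : Distr hH.orbit where
  toFun g := f (fourierInvH1 μ hmem (conjTest g))
  map_add' g g' := by rw [conjTest_add, map_add, map_add]
  map_smul' c g := by
    rw [conjTest_smul, map_smul, map_smulₛₗ, Complex.conj_conj]
    rfl
  cont := (continuous_comp_fourierInvH1 μ hH hw hψ hψ0 hmem f).comp continuous_conjTest

end

end WaveletCoorbit

end

theorem mainTheorem8 {d : ℕ} (H : Subgroup (GL (Fin d) ℝ)) (ξ₀ : WaveletCoorbit.Space d)
    (hH : WaveletCoorbit.IsAdmissible H ξ₀)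
    [MeasurableSpace H] [BorelSpace H] (μ : Measure H) [μ.IsHaarMeasure]
    (w : H → ℝ) (hw : WaveletCoorbit.IsWeight H w)
    (ψ : WaveletCoorbit.L2 d) (hψ : ψ ∈ WaveletCoorbit.analyzing H μ w) (hψ0 : ψ ≠ 0) :
    ∃ hmem : ∀ g : 𝓓(hH.orbit, ℂ),
        WaveletCoorbit.fourierInvTest g ∈ WaveletCoorbit.H1Submodule H μ w ψ,
      ∃ Ft : WaveletCoorbit.Reservoir H μ w ψ → WaveletCoorbit.Distr hH.orbit,
        (∀ (f : WaveletCoorbit.Reservoir H μ w ψ) (g : 𝓓(hH.orbit, ℂ)),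
          Ft f g = f ⟨WaveletCoorbit.fourierInvTest (WaveletCoorbit.conjTest g),
            hmem (WaveletCoorbit.conjTest g)⟩) ∧
        IsLinearMap ℂ Ft ∧ Function.Injective Ft ∧ Continuous Ft := by
  have hmem := WaveletCoorbit.fourierInvTest_mem μ hH hw hψ hψ0
  refine ⟨hmem, WaveletCoorbit.reservoirFourier μ hH hw hψ hψ0 hmem, fun f g => rfl,
    ⟨fun f f' => ContinuousLinearMap.ext fun g => rfl,
      fun c f => ContinuousLinearMap.ext fun g => rfl⟩, fun f f' hff' => ?_, ?_⟩
  -- Conjugation is an involution of test functions, so equal distributions force f and f' to agree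
  -- on every 𝓕⁻¹g, hence everywhere by density.
  · have h1 : (fun x => f x) ∘ WaveletCoorbit.fourierInvH1 μ hmem =
        (fun x => f' x) ∘ WaveletCoorbit.fourierInvH1 μ hmem := by
      funext g
      have h2 := congrArg (fun F : WaveletCoorbit.Distr hH.orbit =>
        F (WaveletCoorbit.conjTest g)) hff'
      change f (WaveletCoorbit.fourierInvH1 μ hmem (WaveletCoorbit.conjTest
        (WaveletCoorbit.conjTest g))) = f' (WaveletCoorbit.fourierInvH1 μ hmem
        (WaveletCoorbit.conjTest (WaveletCoorbit.conjTest g))) at h2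
      rwa [WaveletCoorbit.conjTest_conjTest] at h2
    have h3 := (WaveletCoorbit.denseRange_fourierInvH1 μ hH hw hψ hψ0 hmem).equalizer
      f.continuous f'.continuous h1
    exact ContinuousLinearMap.ext fun x => congrFun h3 x
  -- Evaluating 𝓕f at g is evaluating f at one fixed element of H¹_w, which is weak-* continuous.
  · exact PointwiseConvergenceCLM.continuous_of_continuous_eval fun g =>
      (PointwiseConvergenceCLM.evalCLM _ ℂ
        (WaveletCoorbit.fourierInvH1 μ hmem (WaveletCoorbit.conjTest g))).continuous
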